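/- For a complex square matrix $A$ and $1 \le p < \infty$ let $\|A\|_p = \big(\mathrm{Tr}\,(A^*A)^{p/2}\big)^{1/p}$, and let $\|A\|_\infty$ be the operator norm of $A$ (its largest singular value). Let $X, Y, W, Z$ be arbitrary complex $n \times n$ matrices, and for $1 \le p < \infty$ define the real symmetric $2 \times 2$ matrix $$\alpha = \alpha_p = \begin{pmatrix} \|X\|_p & \big(\tfrac12 \|Y\|_p^p + \tfrac12 \|W\|_p^p\big)^{1/p} \\ \big(\tfrac12 \|Y\|_p^p + \tfrac12 \|W\|_p^p\big)^{1/p} & \|Z\|_p \end{pmatrix}.$$ The following inequalities hold. (a) For $1 \le p \le 2$, $$\left\| \begin{pmatrix} X & Y \\ W & Z \end{pmatrix} \right\|_p \ \ge\ 2^{1/p} \Big[ \tfrac{p-1}{2}\, \mathrm{Tr}(\alpha^2) + \tfrac{2-p}{4}\, (\mathrm{Tr}\,\alpha)^2 \Big]^{1/2}.$$ (b) For $2 \le p \le \infty$, $$\left\| \begin{pmatrix} X & Y \\ W & Z \end{pmatrix} \right\|_p \ \le\ 2^{1/p} \Big[ \tfrac{p-1}{2}\, \mathrm{Tr}(\alpha^2)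 + \tfrac{2-p}{4}\, (\mathrm{Tr}\,\alpha)^2 \Big]^{1/2},$$ where for $p = \infty$ the right side means its limit as $p \to \infty$, which exists in $[0, \infty]$. -/

import Mathlib

open Filter Topology
open scoped ENNReal

noncomputable section

/-- The `p`-norm `‖A‖_p = (Tr (A* A)^{p/2})^{1/p}` of a complex square matrix, for a finite
exponent `p`. The power `(A* A)^{p/2}` of the positive semidefinite matrix `A* A` is taken by the
continuous functional calculus; its trace is a (nonnegative) real number. -/
def pNorm {ι : Type*} [Fintype ι] [DecidableEq ι] (p : ℝ) (A : Matrix ι ι ℂ) : ℝ :=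
  ((cfc (fun t : ℝ => t ^ (p / 2)) (A.conjTranspose * A)).trace.re) ^ (1 / p)

/-- The norm `‖A‖_∞`: the operator norm of `A` on the Euclidean space `ℂ^ι`, that is, the largest
singular value of `A`. -/
def opNorm {ι : Type*} [Fintype ι] [DecidableEq ι] (A : Matrix ι ι ℂ) : ℝ :=
  ‖Matrix.toEuclideanCLM (n := ι) (𝕜 := ℂ) A‖

/-- The symmetric real `2 × 2` matrix `α`, with diagonal entries `‖X‖_p`, `‖Z‖_p` and both
off-diagonal entries `(‖Y‖_p^p / 2 + ‖W‖_p^p / 2)^{1/p}`. -/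
def alphaMatrix {ι : Type*} [Fintype ι] [DecidableEq ι] (p : ℝ) (X Y W Z : Matrix ι ι ℂ) :
    Matrix (Fin 2) (Fin 2) ℝ :=
  !![pNorm p X, ((1 / 2) * pNorm p Y ^ p + (1 / 2) * pNorm p W ^ p) ^ (1 / p);
     ((1 / 2) * pNorm p Y ^ p + (1 / 2) * pNorm p W ^ p) ^ (1 / p), pNorm p Z]

/-- The quantity `2^{1/p} [ (p-1)/2 · Tr(α²) + (2-p)/4 · (Tr α)² ]^{1/2}`. -/
def alphaBound {ι : Type*} [Fintype ι] [DecidableEq ι] (p : ℝ) (X Y W Z : Matrix ι ι ℂ) : ℝ :=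
  (2 : ℝ) ^ (1 / p) *
    Real.sqrt ((p - 1) / 2 * (alphaMatrix p X Y W Z ^ 2).trace +
      (2 - p) / 4 * (alphaMatrix p X Y W Z).trace ^ 2)

end

/-! Split the block matrix as `D + O`, with `D` block diagonal and `O` block off-diagonal. The
grading unitary `diag(1, -1)` fixes `D` and negates `O`, so it exchanges `D + O` and `D - O`. Under
such a symmetry the Ball–Carlen–Lieb inequality reads ‖D + O‖_p² ≤ ‖D‖_p² + (p - 1)‖O‖_p² for p ≥ 2
(`traceAbsRpow_add_le`), and is reversed for 1 < p < 2 (`le_traceAbsRpow_add`). The norm of `O`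
gives the off-diagonal entry of α. Since ‖D‖_p is the ℓ^p norm of (‖X‖_p, ‖Z‖_p), the two-point
inequality finishes the proof; it is the same matrix inequality for diagonal 2 × 2 matrices, with
the coordinate swap as symmetry.

For p ≥ 2 and Hermitian matrices, let S(t) = Tr |D + tO|^p. Convexity bounds its increments by p
Tr(∇(D + tO) O) times the step, where ∇A = A|A|^(p-2). The symmetry turns this trace into half of
Tr((∇A - ∇A')O) with A, A' = D ± tO, so that A - A' = 2tO. The main estimate,
`trace_powGradient_sub_mul_sub_le`, then gives S' ≤ p(p - 1) t ‖O‖_p² S^((p-2)/p), that is,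
(S^(2/p))' ≤ 2(p - 1) t ‖O‖_p², which integrates over [0, 1]. The main estimate is a scalar
inequality summed over pairs of eigenvectors of A and A', followed by the concavity estimate
`sum_norm_sq_mul_rpow_le` and Hölder's inequality.

The range 1 < p < 2 follows by duality, arbitrary matrices reduce to Hermitian ones by dilation, and
the endpoints of (a) follow by continuity in p. At p = ∞ the operator norm is below every p-norm, so
only the existence of the limit remains to be shown. -/

/-! ### Scalar inequalities for |x|^p and its derivative. -/

/-- Convexity of |x|^p in tangent form at `a`, obtained from Young's inequality for |b| · |a|^(p-1).
-/
theorem abs_rpow_sub_le_gradient {p : ℝ} (hp : 1 < p) (a b : ℝ) :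
    |a| ^ p - |b| ^ p ≤ p * (a * |a| ^ (p - 2)) * (a - b) := by
  have hp0 : 0 < p := by linarith
  rcases eq_or_ne a 0 with rfl | ha
  · simp [Real.zero_rpow hp0.ne']
    positivity
  have ha' : 0 < |a| := abs_pos.2 ha
  have hpq := Real.HolderConjugate.conjExponent hp
  have hy := Real.young_inequality_of_nonneg (a := |b|) (b := |a| ^ (p - 1)) (abs_nonneg b)
    (by positivity) hpq
  have hq : (p - 1) * (Real.conjExponent p) = p := by
    unfold Real.conjExponent
    field_simp [sub_ne_zero.2 hp.ne']
  have hqi : (Real.conjExponent p)⁻¹ = (p - 1) / p := by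
    unfold Real.conjExponent
    simp
  rw [← Real.rpow_mul ha'.le, hq, div_eq_mul_inv _ (Real.conjExponent p), hqi] at hy
  have h1 : |a| ^ (p - 1) = |a| ^ (p - 2) * |a| := by
    rw [← Real.rpow_add_one ha'.ne']; ring_nf
  have h2 : |a| ^ p = |a| ^ (p - 2) * (a * a) := by
    rw [← abs_mul_abs_self a, ← mul_assoc, ← h1, ← Real.rpow_add_one ha'.ne']; ring_nf
  have h3 : a * b ≤ |b| * |a| := by rw [← abs_mul, mul_comm b a]; exact le_abs_self _
  have h4 : |a| ^ (p - 2) * (a * b) ≤ |b| * |a| ^ (p - 1) := by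
    rw [h1]
    calc _ ≤ |a| ^ (p - 2) * (|b| * |a|) := by gcongr
      _ = _ := by ring
  have h5 : p * (|b| * |a| ^ (p - 1)) ≤ |b| ^ p + (p - 1) * |a| ^ p := by
    calc _ ≤ p * (|b| ^ p / p + |a| ^ p * ((p - 1) / p)) := by gcongr
      _ = _ := by field_simp
  have h6 : p * (a * |a| ^ (p - 2)) * (a - b) = p * |a| ^ p - p * (|a| ^ (p - 2) * (a * b)) := by
    rw [h2]; ring
  rw [h6]
  nlinarith

/-- The left side is (p - 1) times the integral of x^(p-2) = (x^p)^((p-2)/p) over [b, a]. The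
concave outer power lies below its tangent at `s`, which is weighted AM-GM, and the convex x^p lies
below its chord. The chord has mean exactly `s`. -/
theorem rpow_sub_rpow_le_mean {p a b : ℝ} (hp : 2 < p) (hb : 0 ≤ b) (hab : b < a) :
    a ^ (p - 1) - b ^ (p - 1) ≤ (p - 1) * (a - b) * ((a ^ p + b ^ p) / 2) ^ ((p - 2) / p) := by
  have hp0 : 0 < p := by linarith
  have ha : 0 < a := hb.trans_lt hab
  set s := (a ^ p + b ^ p) / 2 with hs
  have hs0 : 0 < s := by positivity
  have hint : ∫ x in b..a, x ^ (p - 2) = (a ^ (p - 1) - b ^ (p - 1)) / (p - 1) := by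
    rw [integral_rpow (Or.inl (by linarith))]
    ring_nf
  have hbd : ∀ x ∈ Set.Icc b a, x ^ (p - 2) ≤ s ^ ((p - 2) / p) *
      ((p - 2) / p * (s⁻¹ * ((a - b)⁻¹ * ((a - x) * b ^ p + (x - b) * a ^ p))) + 2 / p) := by
    intro x hx
    have hx0 : 0 ≤ x := hb.trans hx.1
    have hch : x ^ p ≤ (a - b)⁻¹ * ((a - x) * b ^ p + (x - b) * a ^ p) := by
      have h := (convexOn_rpow (p := p) (by linarith)).2 (Set.mem_Ici.2 hb) (Set.mem_Ici.2 ha.le)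
        (div_nonneg (a := a - x) (b := a - b) (by linarith [hx.2]) (by linarith))
        (div_nonneg (a := x - b) (b := a - b) (by linarith [hx.1]) (by linarith)) (by field_simp [sub_ne_zero.2 hab.ne']; ring)
      have e : ((a - x) / (a - b)) • b + ((x - b) / (a - b)) • a = x := by
        simp only [smul_eq_mul]; field_simp [sub_ne_zero.2 hab.ne']; ring
      rw [e] at h
      simp only [smul_eq_mul] at h
      calc x ^ p ≤ _ := h
        _ = _ := by ring
    have hyo := Real.geom_mean_le_arith_mean2_weighted (w₁ := (p - 2) / p) (w₂ := 2 / p)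
      (p₁ := s⁻¹ * x ^ p) (p₂ := 1) (div_nonneg (by linarith) hp0.le) (by positivity)
      (by positivity) zero_le_one (by field_simp; ring)
    rw [Real.one_rpow, mul_one, mul_one, Real.mul_rpow (by positivity) (by positivity),
      ← Real.rpow_mul hx0, mul_div_cancel₀ _ hp0.ne', Real.inv_rpow hs0.le] at hyo
    have hsr : 0 < s ^ ((p - 2) / p) := by positivity
    have : x ^ (p - 2) ≤ s ^ ((p - 2) / p) * ((p - 2) / p * (s⁻¹ * x ^ p) + 2 / p) := by
      rw [inv_mul_le_iff₀ hsr] at hyo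
      exact hyo
    refine this.trans ?_
    have : 0 ≤ (p - 2) / p := div_nonneg (by linarith) hp0.le
    gcongr
  have hle : ∫ x in b..a, x ^ (p - 2) ≤ ∫ x in b..a, s ^ ((p - 2) / p) *
      ((p - 2) / p * (s⁻¹ * ((a - b)⁻¹ * ((a - x) * b ^ p + (x - b) * a ^ p))) + 2 / p) := by
    refine intervalIntegral.integral_mono_on hab.le
      (intervalIntegral.intervalIntegrable_rpow' (by linarith)) ?_ hbd
    exact Continuous.intervalIntegrable (by fun_prop) _ _
  have hlin : ∀ α β : ℝ, ∫ x in b..a, (α * x + β) = (a - b) * (α * ((a + b) / 2) + β) := by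
    intro α β
    rw [intervalIntegral.integral_add (Continuous.intervalIntegrable (by fun_prop) _ _)
      (Continuous.intervalIntegrable (by fun_prop) _ _), intervalIntegral.integral_const_mul,
      integral_id, intervalIntegral.integral_const, smul_eq_mul]
    ring
  have hab' : a - b ≠ 0 := sub_ne_zero.2 hab.ne'
  have hval : ∫ x in b..a, s ^ ((p - 2) / p) *
      ((p - 2) / p * (s⁻¹ * ((a - b)⁻¹ * ((a - x) * b ^ p + (x - b) * a ^ p))) + 2 / p) =
      (a - b) * s ^ ((p - 2) / p) := by
    rw [intervalIntegral.integral_const_mul]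
    have e : ∀ x : ℝ, (p - 2) / p * (s⁻¹ * ((a - b)⁻¹ * ((a - x) * b ^ p + (x - b) * a ^ p))) +
        2 / p = ((p - 2) / p * s⁻¹ * (a - b)⁻¹ * (a ^ p - b ^ p)) * x +
          ((p - 2) / p * s⁻¹ * (a - b)⁻¹ * (a * b ^ p - b * a ^ p) + 2 / p) := by
      intro x; ring
    simp_rw [e]
    rw [hlin]
    have : a ^ p + b ^ p = 2 * s := by rw [hs]; ring
    have h2 : ((p - 2) / p * s⁻¹ * (a - b)⁻¹ * (a ^ p - b ^ p)) * ((a + b) / 2) +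
          ((p - 2) / p * s⁻¹ * (a - b)⁻¹ * (a * b ^ p - b * a ^ p) + 2 / p) = 1 := by
      have : ((p - 2) / p * s⁻¹ * (a - b)⁻¹ * (a ^ p - b ^ p)) * ((a + b) / 2) +
          ((p - 2) / p * s⁻¹ * (a - b)⁻¹ * (a * b ^ p - b * a ^ p) + 2 / p) =
          (p - 2) / p * s⁻¹ * ((a - b)⁻¹ * (a - b)) * ((a ^ p + b ^ p) / 2) + 2 / p := by ring
      rw [this, ← hs, inv_mul_cancel₀ hab']
      field_simp
      ring
    rw [h2]; ring
  rw [hval, hint, div_le_iff₀ (by linarith)] at hle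
  linarith

/-- For equal signs this is the mean estimate above. For opposite signs both powers are bounded by
that of the larger modulus; passing to the mean of the p-th powers costs 2^((p-2)/p), which
Bernoulli bounds by p - 1. -/
theorem abs_rpow_gradient_sub_mul_le {p : ℝ} (hp : 2 ≤ p) (a b : ℝ) :
    (a * |a| ^ (p - 2) - b * |b| ^ (p - 2)) * (a - b) ≤
      (p - 1) * ((a - b) ^ 2 * ((|a| ^ p + |b| ^ p) / 2) ^ ((p - 2) / p)) := by
  rcases hp.eq_or_lt with rfl | hp
  · norm_num
    nlinarith
  have hp0 : 0 < p := by linarith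
  have same : ∀ a b : ℝ, 0 ≤ b → b < a → (a * |a| ^ (p - 2) - b * |b| ^ (p - 2)) * (a - b) ≤
      (p - 1) * ((a - b) ^ 2 * ((|a| ^ p + |b| ^ p) / 2) ^ ((p - 2) / p)) := by
    intro a b hb hab
    have ha : 0 ≤ a := by linarith
    have e : ∀ x : ℝ, 0 ≤ x → x * |x| ^ (p - 2) = x ^ (p - 1) := by
      intro x hx
      rw [abs_of_nonneg hx, mul_comm, ← Real.rpow_add_one' hx (by linarith)]
      ring_nf
    rw [e a ha, e b hb, abs_of_nonneg ha, abs_of_nonneg hb]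
    have := mul_le_mul_of_nonneg_right (rpow_sub_rpow_le_mean hp hb hab) (sub_nonneg.2 hab.le)
    calc _ ≤ _ := this
      _ = _ := by ring
  have opp : ∀ a b : ℝ, b ≤ 0 → 0 ≤ a → (a * |a| ^ (p - 2) - b * |b| ^ (p - 2)) * (a - b) ≤
      (p - 1) * ((a - b) ^ 2 * ((|a| ^ p + |b| ^ p) / 2) ^ ((p - 2) / p)) := by
    intro a b hb ha
    set m := max |a| |b|
    have hm : 0 ≤ m := (abs_nonneg a).trans (le_max_left _ _)
    have h1 : a * |a| ^ (p - 2) - b * |b| ^ (p - 2) ≤ (a - b) * m ^ (p - 2) := by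
      have h2 : |a| ^ (p - 2) ≤ m ^ (p - 2) :=
        Real.rpow_le_rpow (abs_nonneg _) (le_max_left _ _) (by linarith)
      have h3 : |b| ^ (p - 2) ≤ m ^ (p - 2) :=
        Real.rpow_le_rpow (abs_nonneg _) (le_max_right _ _) (by linarith)
      nlinarith
    have h2 : m ^ p ≤ |a| ^ p + |b| ^ p := by
      rcases max_choice |a| |b| with h | h <;> simp only [m, h]
      · linarith [Real.rpow_nonneg (abs_nonneg b) p]
      · linarith [Real.rpow_nonneg (abs_nonneg a) p]
    have h3 : m ^ (p - 2) ≤ (p - 1) * ((|a| ^ p + |b| ^ p) / 2) ^ ((p - 2) / p) := by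
      have e1 : m ^ (p - 2) = (m ^ p) ^ ((p - 2) / p) := by
        rw [← Real.rpow_mul hm, mul_div_cancel₀ _ hp0.ne']
      have hr : 0 ≤ (p - 2) / p := div_nonneg (by linarith) hp0.le
      have hr1 : (p - 2) / p ≤ 1 := by rw [div_le_one hp0]; linarith
      have e2 : (2 : ℝ) ^ ((p - 2) / p) ≤ p - 1 := by
        have := rpow_one_add_le_one_add_mul_self (s := 1) (by norm_num) hr hr1
        have h4 : (p - 2) / p ≤ p - 2 := div_le_self (by linarith) (by linarith)
        norm_num at this
        linarith
      calc m ^ (p - 2) = (m ^ p) ^ ((p - 2) / p) := e1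
        _ ≤ (2 * ((|a| ^ p + |b| ^ p) / 2)) ^ ((p - 2) / p) := by
            apply Real.rpow_le_rpow (by positivity) (by linarith) hr
        _ = 2 ^ ((p - 2) / p) * ((|a| ^ p + |b| ^ p) / 2) ^ ((p - 2) / p) :=
            Real.mul_rpow (by norm_num) (by positivity)
        _ ≤ _ := by gcongr
    have hab : 0 ≤ a - b := by linarith
    calc _ ≤ ((a - b) * m ^ (p - 2)) * (a - b) := by gcongr
      _ ≤ ((a - b) * ((p - 1) * ((|a| ^ p + |b| ^ p) / 2) ^ ((p - 2) / p))) * (a - b) := by gcongr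
      _ = _ := by ring
  have main : ∀ a b : ℝ, b ≤ a → (a * |a| ^ (p - 2) - b * |b| ^ (p - 2)) * (a - b) ≤
      (p - 1) * ((a - b) ^ 2 * ((|a| ^ p + |b| ^ p) / 2) ^ ((p - 2) / p)) := by
    intro a b hab
    rcases hab.eq_or_lt with rfl | hab
    · simp
    rcases le_total 0 b with hb | hb
    · exact same a b hb hab
    rcases le_total 0 a with ha | ha
    · exact opp a b hb ha
    · have := same (-b) (-a) (by linarith) (by linarith)
      simp only [abs_neg] at this
      calc _ = (-b * |b| ^ (p - 2) - -a * |a| ^ (p - 2)) * (-b - -a) := by ring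
        _ ≤ _ := this
        _ = _ := by rw [add_comm (|b| ^ p)]; ring
  rcases le_total b a with h | h
  · exact main a b h
  · have := main b a h
    calc _ = (b * |b| ^ (p - 2) - a * |a| ^ (p - 2)) * (b - a) := by ring
      _ ≤ _ := this
      _ = _ := by rw [add_comm (|b| ^ p)]; ring

/-! ### Weighted sums of squared matrix entries. -/

theorem sum_norm_sq_unitary_row {ι : Type*} [Fintype ι] [DecidableEq ι]
    (X : Matrix.unitaryGroup ι ℂ) (i : ι) : ∑ k, ‖(X : Matrix ι ι ℂ) i k‖ ^ 2 = 1 := by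
  have h := congrFun (congrFun (Matrix.mem_unitaryGroup_iff.1 X.2) i) i
  rw [Matrix.mul_apply, Matrix.one_apply_eq] at h
  simp only [Matrix.star_apply, RCLike.star_def, Complex.mul_conj'] at h
  exact_mod_cast h

theorem sum_norm_sq_unitary_col {ι : Type*} [Fintype ι] [DecidableEq ι]
    (X : Matrix.unitaryGroup ι ℂ) (k : ι) : ∑ i, ‖(X : Matrix ι ι ℂ) i k‖ ^ 2 = 1 := by
  have h := sum_norm_sq_unitary_row (star X) k
  simpa [Matrix.star_apply] using h

theorem sum_norm_sq_row_mul_diagonal_mul {ι : Type*} [Fintype ι] [DecidableEq ι]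
    (X Y : Matrix.unitaryGroup ι ℂ) (γ : ι → ℝ) (i : ι) :
    ∑ j, ‖((X : Matrix ι ι ℂ) * Matrix.diagonal (fun k => (γ k : ℂ)) * star (Y : Matrix ι ι ℂ)) i j‖ ^ 2
      = ∑ k, γ k ^ 2 * ‖(X : Matrix ι ι ℂ) i k‖ ^ 2 := by
  set G := Matrix.diagonal (fun k => (γ k : ℂ))
  set M := (X : Matrix ι ι ℂ) * G * star (Y : Matrix ι ι ℂ) with hM
  have h : M * star M = (X : Matrix ι ι ℂ) * (G * star G) * star (X : Matrix ι ι ℂ) := by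
    rw [hM, star_mul, star_mul, star_star]
    have := Matrix.mem_unitaryGroup_iff'.1 Y.2
    calc _ = (X : Matrix ι ι ℂ) * G * (star (Y : Matrix ι ι ℂ) * Y) * star G * star (X : Matrix ι ι ℂ) := by
          noncomm_ring
      _ = _ := by rw [this]; noncomm_ring
  have h2 := congrFun (congrFun h i) i
  simp only [G, Matrix.star_eq_conjTranspose, Matrix.diagonal_conjTranspose,
    Matrix.diagonal_mul_diagonal] at h2
  rw [Matrix.mul_apply, Matrix.mul_apply] at h2
  simp only [Matrix.conjTranspose_apply, RCLike.star_def, Complex.mul_conj', Matrix.mul_diagonal,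
    Pi.star_apply] at h2
  have h3 : ∀ k, (X : Matrix ι ι ℂ) i k * (γ k : ℂ) ^ 2 * (starRingEnd ℂ) ((X : Matrix ι ι ℂ) i k) =
      ((γ k ^ 2 * ‖(X : Matrix ι ι ℂ) i k‖ ^ 2 : ℝ) : ℂ) := by
    intro k
    push_cast
    rw [← Complex.mul_conj']; ring
  simp only [Complex.norm_real, Real.norm_eq_abs, ← Complex.ofReal_pow, sq_abs] at h2
  simp only [Complex.ofReal_pow, h3] at h2
  exact_mod_cast h2

theorem sum_norm_sq_col_mul_diagonal_mul {ι : Type*} [Fintype ι] [DecidableEq ι]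
    (X Y : Matrix.unitaryGroup ι ℂ) (γ : ι → ℝ) (j : ι) :
    ∑ i, ‖((X : Matrix ι ι ℂ) * Matrix.diagonal (fun k => (γ k : ℂ)) * star (Y : Matrix ι ι ℂ)) i j‖ ^ 2
      = ∑ k, γ k ^ 2 * ‖(Y : Matrix ι ι ℂ) j k‖ ^ 2 := by
  rw [← sum_norm_sq_row_mul_diagonal_mul Y X γ j]
  refine Finset.sum_congr rfl fun i _ => ?_
  have : (Y : Matrix ι ι ℂ) * Matrix.diagonal (fun k => (γ k : ℂ)) * star (X : Matrix ι ι ℂ) =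
      star ((X : Matrix ι ι ℂ) * Matrix.diagonal (fun k => (γ k : ℂ)) * star (Y : Matrix ι ι ℂ)) := by
    rw [star_mul, star_mul, star_star, mul_assoc]
    congr 2
    rw [Matrix.star_eq_conjTranspose, Matrix.diagonal_conjTranspose]
    congr 1
    ext k
    simp
  rw [this, Matrix.star_apply, norm_star]

/-- The average of the row weights `c` and column weights `c'` seen by the `k`-th columns of the
unitaries `X` and `Y`. -/
noncomputable def columnWeight {ι : Type*} [Fintype ι] [DecidableEq ι]
    (X Y : Matrix.unitaryGroup ι ℂ) (c c' : ι → ℝ) (k : ι) : ℝ :=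
  (∑ i, ‖(X : Matrix ι ι ℂ) i k‖ ^ 2 * c i + ∑ j, ‖(Y : Matrix ι ι ℂ) j k‖ ^ 2 * c' j) / 2

theorem columnWeight_nonneg {ι : Type*} [Fintype ι] [DecidableEq ι]
    (X Y : Matrix.unitaryGroup ι ℂ) {c c' : ι → ℝ} (hc : ∀ i, 0 ≤ c i) (hc' : ∀ j, 0 ≤ c' j)
    (k : ι) : 0 ≤ columnWeight X Y c c' k := by
  have h1 : 0 ≤ ∑ i, ‖(X : Matrix ι ι ℂ) i k‖ ^ 2 * c i :=
    Finset.sum_nonneg fun i _ => mul_nonneg (by positivity) (hc i)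
  have h2 : 0 ≤ ∑ i, ‖(Y : Matrix ι ι ℂ) i k‖ ^ 2 * c' i :=
    Finset.sum_nonneg fun i _ => mul_nonneg (by positivity) (hc' i)
  unfold columnWeight
  linarith

theorem sum_columnWeight {ι : Type*} [Fintype ι] [DecidableEq ι]
    (X Y : Matrix.unitaryGroup ι ℂ) (c c' : ι → ℝ) :
    ∑ k, columnWeight X Y c c' k = (∑ i, c i + ∑ j, c' j) / 2 := by
  unfold columnWeight
  rw [← Finset.sum_div, Finset.sum_add_distrib, Finset.sum_comm,
    Finset.sum_comm (f := fun k j => ‖(Y : Matrix ι ι ℂ) j k‖ ^ 2 * c' j)]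
  simp only [← Finset.sum_mul, sum_norm_sq_unitary_row, one_mul]

/-- A weight that is additive in row and column only sees the row and column sums of squares, the
diagonals of M M* and M* M. This is the linear case, with equality, of the concave estimate below.
-/
theorem sum_norm_sq_mul_weight {ι : Type*} [Fintype ι] [DecidableEq ι]
    (X Y : Matrix.unitaryGroup ι ℂ) (γ c c' : ι → ℝ) :
    ∑ i, ∑ j, ‖((X : Matrix ι ι ℂ) * Matrix.diagonal (fun k => (γ k : ℂ)) *
        star (Y : Matrix ι ι ℂ)) i j‖ ^ 2 * ((c i + c' j) / 2) =
      ∑ k, γ k ^ 2 * columnWeight X Y c c' k := by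
  set M := (X : Matrix ι ι ℂ) * Matrix.diagonal (fun k => (γ k : ℂ)) * star (Y : Matrix ι ι ℂ)
  have e : ∀ i j, ‖M i j‖ ^ 2 * ((c i + c' j) / 2) = ‖M i j‖ ^ 2 * c i / 2 + ‖M i j‖ ^ 2 * c' j / 2 := by
    intro i j; ring
  simp only [e, Finset.sum_add_distrib]
  rw [Finset.sum_comm (f := fun i j => ‖M i j‖ ^ 2 * c' j / 2)]
  simp only [← Finset.sum_div, ← Finset.sum_mul]
  simp only [M, sum_norm_sq_row_mul_diagonal_mul, sum_norm_sq_col_mul_diagonal_mul]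
  simp only [Finset.sum_mul]
  rw [Finset.sum_comm, Finset.sum_comm (f := fun j k => γ k ^ 2 * ‖(Y : Matrix ι ι ℂ) j k‖ ^ 2 * c' j),
    ← add_div, ← Finset.sum_add_distrib, Finset.sum_div]
  refine Finset.sum_congr rfl fun k _ => ?_
  unfold columnWeight
  rw [mul_div_assoc', mul_add, Finset.mul_sum, Finset.mul_sum]
  simp only [mul_assoc]

theorem sum_norm_sq_mul_diagonal_mul {ι : Type*} [Fintype ι] [DecidableEq ι]
    (X Y : Matrix.unitaryGroup ι ℂ) (γ : ι → ℝ) :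
    ∑ i, ∑ j, ‖((X : Matrix ι ι ℂ) * Matrix.diagonal (fun k => (γ k : ℂ)) *
        star (Y : Matrix ι ι ℂ)) i j‖ ^ 2 = ∑ k, γ k ^ 2 := by
  simp only [sum_norm_sq_row_mul_diagonal_mul]
  rw [Finset.sum_comm]
  simp only [← Finset.mul_sum, sum_norm_sq_unitary_col, mul_one]

/-- x/(x + t) is the parallel sum of 1 and x/t, hence the least cost of splitting a unit vector
between these two quadratic weights. -/
theorem norm_add_sq_mul_div_le (e c : ℂ) {x t : ℝ} (hx : 0 ≤ x) (ht : 0 < t) :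
    ‖e + c‖ ^ 2 * (x / (x + t)) ≤ ‖e‖ ^ 2 + ‖c‖ ^ 2 * x / t := by
  have h1 : ‖e + c‖ ^ 2 ≤ (‖e‖ + ‖c‖) ^ 2 := by gcongr; exact norm_add_le _ _
  have hxt : 0 < x + t := by linarith
  have h2 : (‖e‖ + ‖c‖) ^ 2 * x * t ≤ (‖e‖ ^ 2 * t + ‖c‖ ^ 2 * x) * (x + t) := by
    nlinarith [sq_nonneg (‖e‖ * t - ‖c‖ * x)]
  calc _ ≤ (‖e‖ + ‖c‖) ^ 2 * (x / (x + t)) := by gcongr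
    _ ≤ _ := by
      rw [mul_div_assoc', div_le_iff₀ hxt]
      have : (‖e‖ ^ 2 + ‖c‖ ^ 2 * x / t) * (x + t) =
        ((‖e‖ ^ 2 * t + ‖c‖ ^ 2 * x) * (x + t)) / t := by field_simp
      rw [this, le_div_iff₀ ht]
      exact h2

/-- Any splitting of the matrix bounds the left side by costs that are at most linear in the
weights, and these are computed exactly. -/
theorem sum_norm_sq_mul_div_le {ι : Type*} [Fintype ι] [DecidableEq ι]
    (X Y : Matrix.unitaryGroup ι ℂ) (β : ι → ℝ) {c c' : ι → ℝ}
    (hc : ∀ i, 0 ≤ c i) (hc' : ∀ j, 0 ≤ c' j) {t : ℝ} (ht : 0 < t) :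
    ∑ i, ∑ j, ‖((X : Matrix ι ι ℂ) * Matrix.diagonal (fun k => (β k : ℂ)) *
        star (Y : Matrix ι ι ℂ)) i j‖ ^ 2 * (((c i + c' j) / 2) / ((c i + c' j) / 2 + t)) ≤
      ∑ k, β k ^ 2 * (columnWeight X Y c c' k / (columnWeight X Y c c' k + t)) := by
  set d := columnWeight X Y c c' with hd
  have hd0 : ∀ k, 0 ≤ d k := columnWeight_nonneg X Y hc hc'
  -- The splitting of `β k` that is optimal for the averaged weight `d k`, so the bound becomes an
  -- equality on the right side.
  set e : ι → ℝ := fun k => d k / (d k + t) * β k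
  set g : ι → ℝ := fun k => t / (d k + t) * β k
  have hsplit : (X : Matrix ι ι ℂ) * Matrix.diagonal (fun k => (β k : ℂ)) * star (Y : Matrix ι ι ℂ)
      = (X : Matrix ι ι ℂ) * Matrix.diagonal (fun k => (e k : ℂ)) * star (Y : Matrix ι ι ℂ) +
        (X : Matrix ι ι ℂ) * Matrix.diagonal (fun k => (g k : ℂ)) * star (Y : Matrix ι ι ℂ) := by
    rw [← add_mul, ← mul_add, Matrix.diagonal_add]
    congr 3
    ext k
    rw [← Complex.ofReal_add]
    congr 1
    simp only [e, g]
    have : d k + t ≠ 0 := by linarith [hd0 k]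
    field_simp
  rw [hsplit]
  calc _ ≤ ∑ i, ∑ j, (‖((X : Matrix ι ι ℂ) * Matrix.diagonal (fun k => (e k : ℂ)) *
        star (Y : Matrix ι ι ℂ)) i j‖ ^ 2 + ‖((X : Matrix ι ι ℂ) * Matrix.diagonal (fun k => (g k : ℂ)) *
        star (Y : Matrix ι ι ℂ)) i j‖ ^ 2 * ((c i + c' j) / 2) / t) :=
        Finset.sum_le_sum fun i _ => Finset.sum_le_sum fun j _ =>
          norm_add_sq_mul_div_le _ _ (by linarith [hc i, hc' j]) ht
    _ = ∑ k, e k ^ 2 + (∑ k, g k ^ 2 * d k) / t := by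
        simp only [Finset.sum_add_distrib, ← Finset.sum_div]
        rw [sum_norm_sq_mul_diagonal_mul, sum_norm_sq_mul_weight]
    _ = _ := by
        rw [Finset.sum_div, ← Finset.sum_add_distrib]
        refine Finset.sum_congr rfl fun k _ => ?_
        simp only [e, g]
        have : d k + t ≠ 0 := by linarith [hd0 k]
        field_simp

/-- For 0 < r < 1 the power x^r is a positive integral over t of multiples of x/(x + t), so the
preceding estimate can be integrated. It plays the role of operator concavity. -/
theorem sum_norm_sq_mul_rpow_le {ι : Type*} [Fintype ι] [DecidableEq ι]
    (X Y : Matrix.unitaryGroup ι ℂ) (β : ι → ℝ) {c c' : ι → ℝ}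
    (hc : ∀ i, 0 ≤ c i) (hc' : ∀ j, 0 ≤ c' j) {r : ℝ} (hr : r ∈ Set.Ioo 0 1) :
    ∑ i, ∑ j, ‖((X : Matrix ι ι ℂ) * Matrix.diagonal (fun k => (β k : ℂ)) *
        star (Y : Matrix ι ι ℂ)) i j‖ ^ 2 * ((c i + c' j) / 2) ^ r ≤
      ∑ k, β k ^ 2 * columnWeight X Y c c' k ^ r := by
  obtain ⟨μ, hμ⟩ := Real.exists_measure_rpow_eq_integral_rpowIntegrand₀₁ hr
  set d := columnWeight X Y c c' with hd
  have hd0 : ∀ k, 0 ≤ d k := columnWeight_nonneg X Y hc hc'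
  have hx0 : ∀ i j, 0 ≤ (c i + c' j) / 2 := fun i j => by linarith [hc i, hc' j]
  set m : ι → ι → ℝ := fun i j => ‖((X : Matrix ι ι ℂ) * Matrix.diagonal (fun k => (β k : ℂ)) *
        star (Y : Matrix ι ι ℂ)) i j‖ ^ 2 with hm
  have hL : ∑ i, ∑ j, m i j * ((c i + c' j) / 2) ^ r =
      ∫ t in Set.Ioi 0, ∑ i, ∑ j, m i j * Real.rpowIntegrand₀₁ r t ((c i + c' j) / 2) ∂μ := by
    rw [MeasureTheory.integral_finsetSum]
    · refine Finset.sum_congr rfl fun i _ => ?_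
      rw [MeasureTheory.integral_finsetSum]
      · refine Finset.sum_congr rfl fun j _ => ?_
        rw [MeasureTheory.integral_const_mul, (hμ _ (hx0 i j)).2]
      · exact fun j _ => (hμ _ (hx0 i j)).1.const_mul _
    · exact fun i _ => MeasureTheory.integrable_finsetSum _ fun j _ =>
        (hμ _ (hx0 i j)).1.const_mul _
  have hR : ∑ k, β k ^ 2 * d k ^ r =
      ∫ t in Set.Ioi 0, ∑ k, β k ^ 2 * Real.rpowIntegrand₀₁ r t (d k) ∂μ := by
    rw [MeasureTheory.integral_finsetSum]
    · refine Finset.sum_congr rfl fun k _ => ?_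
      rw [MeasureTheory.integral_const_mul, (hμ _ (hd0 k)).2]
    · exact fun k _ => (hμ _ (hd0 k)).1.const_mul _
  rw [hL, hR]
  refine MeasureTheory.setIntegral_mono_on ?_ ?_ measurableSet_Ioi ?_
  · exact MeasureTheory.integrable_finsetSum _ fun i _ =>
      MeasureTheory.integrable_finsetSum _ fun j _ => (hμ _ (hx0 i j)).1.const_mul _
  · exact MeasureTheory.integrable_finsetSum _ fun k _ => (hμ _ (hd0 k)).1.const_mul _
  · intro t ht
    have ht : 0 < t := ht
    have e : ∀ x, 0 ≤ x → Real.rpowIntegrand₀₁ r t x = t ^ (r - 1) * (x / (x + t)) := by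
      intro x hx
      rw [Real.rpowIntegrand₀₁_eq_pow_div hr ht.le hx, add_comm, mul_div_assoc]
    have h := mul_le_mul_of_nonneg_left (sum_norm_sq_mul_div_le X Y β hc hc' ht)
      (Real.rpow_nonneg ht.le (r - 1))
    rw [Finset.mul_sum, Finset.mul_sum] at h
    simp only [Finset.mul_sum] at h
    convert h using 1
    · refine Finset.sum_congr rfl fun i _ => Finset.sum_congr rfl fun j _ => ?_
      rw [e _ (hx0 i j)]
      simp only [hm]
      ring
    · refine Finset.sum_congr rfl fun k _ => ?_
      rw [e _ (hd0 k)]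
      ring

/-- Hölder with the conjugate exponents p/2 and p/(p - 2). -/
theorem sum_sq_mul_rpow_le {ι : Type*} [Fintype ι] (β d : ι → ℝ) (hd : ∀ k, 0 ≤ d k)
    {p : ℝ} (hp : 2 < p) :
    ∑ k, β k ^ 2 * d k ^ ((p - 2) / p) ≤ (∑ k, |β k| ^ p) ^ (2 / p) * (∑ k, d k) ^ ((p - 2) / p) := by
  have hp0 : 0 < p := by linarith
  have hp2 : p - 2 ≠ 0 := by linarith
  have hpq : (p / 2).HolderConjugate (p / (p - 2)) :=
    Real.holderConjugate_iff.2 ⟨by linarith, by field_simp; ring⟩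
  have h := Real.inner_le_Lp_mul_Lq_of_nonneg Finset.univ hpq
    (f := fun k => β k ^ 2) (g := fun k => d k ^ ((p - 2) / p)) (fun k _ => by positivity)
    (fun k _ => Real.rpow_nonneg (hd k) _)
  have e1 : ∀ k, (β k ^ 2) ^ (p / 2) = |β k| ^ p := by
    intro k
    rw [← sq_abs, ← Real.rpow_natCast, ← Real.rpow_mul (abs_nonneg _)]
    congr 1; push_cast; field_simp
  have e2 : ∀ k, (d k ^ ((p - 2) / p)) ^ (p / (p - 2)) = d k := by
    intro k
    rw [← Real.rpow_mul (hd k)]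
    have : (p - 2) / p * (p / (p - 2)) = 1 := by field_simp
    rw [this, Real.rpow_one]
  simp only [e1, e2, one_div_div] at h
  exact h

theorem sum_norm_sq_mul_rpow_le_holder {ι : Type*} [Fintype ι] [DecidableEq ι]
    (X Y : Matrix.unitaryGroup ι ℂ) (β : ι → ℝ) {c c' : ι → ℝ}
    (hc : ∀ i, 0 ≤ c i) (hc' : ∀ j, 0 ≤ c' j) {p : ℝ} (hp : 2 ≤ p) :
    ∑ i, ∑ j, ‖((X : Matrix ι ι ℂ) * Matrix.diagonal (fun k => (β k : ℂ)) *
        star (Y : Matrix ι ι ℂ)) i j‖ ^ 2 * ((c i + c' j) / 2) ^ ((p - 2) / p) ≤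
      (∑ k, |β k| ^ p) ^ (2 / p) * ((∑ i, c i + ∑ j, c' j) / 2) ^ ((p - 2) / p) := by
  rcases hp.eq_or_lt with rfl | hp
  · simp [sum_norm_sq_mul_diagonal_mul]
  have hp0 : 0 < p := by linarith
  refine (sum_norm_sq_mul_rpow_le X Y β hc hc' ⟨div_pos (by linarith) hp0, ?_⟩).trans ?_
  · rw [div_lt_one hp0]; linarith
  rw [← sum_columnWeight X Y]
  exact sum_sq_mul_rpow_le β _ (columnWeight_nonneg X Y hc hc') hp

/-! ### Traces of functions of two Hermitian matrices. -/

section Hermitian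

variable {ι : Type*} [Fintype ι] [DecidableEq ι]

theorem cfc_eq_mul_diagonal_mul {A : Matrix ι ι ℂ} (hA : A.IsHermitian) (g : ℝ → ℝ) :
    cfc g A = (hA.eigenvectorUnitary : Matrix ι ι ℂ) *
      Matrix.diagonal (fun i => (g (hA.eigenvalues i) : ℂ)) *
        star (hA.eigenvectorUnitary : Matrix ι ι ℂ) := by
  rw [hA.cfc_eq, Matrix.IsHermitian.cfc, Unitary.conjStarAlgAut_apply]
  rfl

theorem eq_mul_diagonal_mul {A : Matrix ι ι ℂ} (hA : A.IsHermitian) :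
    A = (hA.eigenvectorUnitary : Matrix ι ι ℂ) *
      Matrix.diagonal (fun i => (hA.eigenvalues i : ℂ)) *
        star (hA.eigenvectorUnitary : Matrix ι ι ℂ) := by
  conv_lhs => rw [hA.spectral_theorem, Unitary.conjStarAlgAut_apply]
  rfl

theorem continuousOn_spectrum_matrix (A : Matrix ι ι ℂ) (g : ℝ → ℝ) :
    ContinuousOn g (spectrum ℝ A) :=
  Matrix.finite_real_spectrum.continuousOn g

theorem cfc_id_matrix {A : Matrix ι ι ℂ} (hA : A.IsHermitian) :
    cfc (fun x : ℝ => x) A = A := cfc_id' ℝ A hA.isSelfAdjoint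

theorem isHermitian_cfc (A : Matrix ι ι ℂ) (g : ℝ → ℝ) : (cfc g A).IsHermitian :=
  cfc_predicate g A

theorem cfc_unitary_conj {A : Matrix ι ι ℂ} (hA : A.IsHermitian) (J : Matrix.unitaryGroup ι ℂ)
    (g : ℝ → ℝ) : cfc g ((J : Matrix ι ι ℂ) * A * star (J : Matrix ι ι ℂ)) =
      (J : Matrix ι ι ℂ) * cfc g A * star (J : Matrix ι ι ℂ) := by
  have hJ : ∀ x, Unitary.conjStarAlgAut ℂ (Matrix ι ι ℂ) J x =
      (J : Matrix ι ι ℂ) * x * star (J : Matrix ι ι ℂ) :=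
    fun x => Unitary.conjStarAlgAut_apply J x
  have h := StarAlgHomClass.map_cfc (S := ℂ) (Unitary.conjStarAlgAut ℂ (Matrix ι ι ℂ) J) g A
    (continuousOn_spectrum_matrix A g)
    (by
      have : (⇑(Unitary.conjStarAlgAut ℂ (Matrix ι ι ℂ) J)) =
          fun x => (J : Matrix ι ι ℂ) * x * star (J : Matrix ι ι ℂ) := funext hJ
      rw [this]
      fun_prop)
    hA.isSelfAdjoint (hA.isSelfAdjoint.map _)
  rw [hJ, hJ] at h
  exact h.symm

/-- The unitary matrix of change of basis between the eigenbases of two Hermitian matrices. -/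
noncomputable def eigenbasisChange {A A' : Matrix ι ι ℂ} (hA : A.IsHermitian)
    (hA' : A'.IsHermitian) : Matrix.unitaryGroup ι ℂ :=
  star hA.eigenvectorUnitary * hA'.eigenvectorUnitary

/-- The squared overlaps of the eigenvectors of two Hermitian matrices. -/
noncomputable def overlap {A A' : Matrix ι ι ℂ} (hA : A.IsHermitian) (hA' : A'.IsHermitian)
    (i j : ι) : ℝ := ‖(eigenbasisChange hA hA' : Matrix ι ι ℂ) i j‖ ^ 2

theorem overlap_nonneg {A A' : Matrix ι ι ℂ} (hA : A.IsHermitian) (hA' : A'.IsHermitian)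
    (i j : ι) : 0 ≤ overlap hA hA' i j := by unfold overlap; positivity

theorem sum_overlap_right {A A' : Matrix ι ι ℂ} (hA : A.IsHermitian) (hA' : A'.IsHermitian)
    (i : ι) : ∑ j, overlap hA hA' i j = 1 := sum_norm_sq_unitary_row _ i

theorem sum_overlap_left {A A' : Matrix ι ι ℂ} (hA : A.IsHermitian) (hA' : A'.IsHermitian)
    (j : ι) : ∑ i, overlap hA hA' i j = 1 := sum_norm_sq_unitary_col _ j

/-- The overlaps form a doubly stochastic matrix, so this formula and the two one-matrix versions
below reduce trace inequalities to scalar ones for each pair of eigenvalues. -/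
theorem trace_cfc_mul_cfc {A A' : Matrix ι ι ℂ} (hA : A.IsHermitian) (hA' : A'.IsHermitian)
    (g h : ℝ → ℝ) : (cfc g A * cfc h A').trace.re =
      ∑ i, ∑ j, g (hA.eigenvalues i) * h (hA'.eigenvalues j) * overlap hA hA' i j := by
  rw [cfc_eq_mul_diagonal_mul hA, cfc_eq_mul_diagonal_mul hA']
  set U := (hA.eigenvectorUnitary : Matrix ι ι ℂ)
  set V := (hA'.eigenvectorUnitary : Matrix ι ι ℂ)
  set D := Matrix.diagonal (fun i => (g (hA.eigenvalues i) : ℂ)) with hD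
  set D' := Matrix.diagonal (fun i => (h (hA'.eigenvalues i) : ℂ)) with hD'
  have e : (U * D * star U * (V * D' * star V)).trace =
      ((D * (star U * V)) * (D' * star (star U * V))).trace := by
    rw [star_mul, star_star]
    calc _ = (U * (D * (star U * V) * D' * star V)).trace := by simp only [mul_assoc]
      _ = _ := by rw [Matrix.trace_mul_comm]; simp only [mul_assoc]
  rw [e]
  have hW : star U * V = (eigenbasisChange hA hA' : Matrix ι ι ℂ) := rfl
  rw [hW]
  rw [Matrix.trace, Complex.re_sum]
  refine Finset.sum_congr rfl fun i _ => ?_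
  rw [Matrix.diag_apply, Matrix.mul_apply, Complex.re_sum]
  refine Finset.sum_congr rfl fun j _ => ?_
  rw [hD, hD', Matrix.diagonal_mul, Matrix.diagonal_mul, Matrix.star_apply]
  unfold overlap
  set z := (eigenbasisChange hA hA' : Matrix ι ι ℂ) i j
  have : (g (hA.eigenvalues i) : ℂ) * z * ((h (hA'.eigenvalues j) : ℂ) * star z) =
      ((g (hA.eigenvalues i) * h (hA'.eigenvalues j) * ‖z‖ ^ 2 : ℝ) : ℂ) := by
    push_cast
    rw [← Complex.mul_conj', RCLike.star_def]; ring
  rw [this, Complex.ofReal_re]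

theorem trace_cfc {A : Matrix ι ι ℂ} (hA : A.IsHermitian) (g : ℝ → ℝ) :
    (cfc g A).trace.re = ∑ i, g (hA.eigenvalues i) := by
  rw [cfc_eq_mul_diagonal_mul hA, Matrix.trace_mul_comm, ← mul_assoc,
    Matrix.mem_unitaryGroup_iff'.1 hA.eigenvectorUnitary.2, one_mul, Matrix.trace_diagonal,
    Complex.re_sum]
  simp

theorem trace_cfc_eq_sum_left {A A' : Matrix ι ι ℂ} (hA : A.IsHermitian) (hA' : A'.IsHermitian)
    (g : ℝ → ℝ) :
    (cfc g A).trace.re = ∑ i, ∑ j, g (hA.eigenvalues i) * overlap hA hA' i j := by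
  simp only [trace_cfc hA, ← Finset.mul_sum, sum_overlap_right, mul_one]

theorem trace_cfc_eq_sum_right {A A' : Matrix ι ι ℂ} (hA : A.IsHermitian) (hA' : A'.IsHermitian)
    (g : ℝ → ℝ) :
    (cfc g A').trace.re = ∑ i, ∑ j, g (hA'.eigenvalues j) * overlap hA hA' i j := by
  rw [Finset.sum_comm]
  simp only [trace_cfc hA', ← Finset.mul_sum, sum_overlap_left, mul_one]

theorem trace_cfc_mul_self {A : Matrix ι ι ℂ} (hA : A.IsHermitian) (g : ℝ → ℝ) :
    (cfc g A * A).trace.re = (cfc (fun x => g x * x) A).trace.re := by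
  conv_lhs => rw [← cfc_id_matrix hA, cfc_id_matrix hA]
  rw [cfc_mul g (fun x => x) A (continuousOn_spectrum_matrix A _)
    (continuousOn_spectrum_matrix A _), cfc_id_matrix hA]

/-- `Tr |A|^p` for a Hermitian matrix `A`. -/
noncomputable def traceAbsRpow (p : ℝ) (A : Matrix ι ι ℂ) : ℝ :=
  (cfc (fun x : ℝ => |x| ^ p) A).trace.re

/-- The gradient `A |A|^(p-2)` of `Tr |A|^p / p`. -/
noncomputable def powGradient (p : ℝ) (A : Matrix ι ι ℂ) : Matrix ι ι ℂ :=
  cfc (fun x : ℝ => x * |x| ^ (p - 2)) A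

theorem traceAbsRpow_eq_sum {A : Matrix ι ι ℂ} (hA : A.IsHermitian) (p : ℝ) :
    traceAbsRpow p A = ∑ i, |hA.eigenvalues i| ^ p := trace_cfc hA _

theorem traceAbsRpow_nonneg {A : Matrix ι ι ℂ} (hA : A.IsHermitian) (p : ℝ) :
    0 ≤ traceAbsRpow p A := by
  rw [traceAbsRpow_eq_sum hA]
  positivity

/-- Klein's inequality: the scalar tangent-line bound, averaged against the overlaps. -/
theorem traceAbsRpow_sub_le {A A' : Matrix ι ι ℂ} (hA : A.IsHermitian) (hA' : A'.IsHermitian)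
    {p : ℝ} (hp : 1 < p) :
    traceAbsRpow p A - traceAbsRpow p A' ≤ p * (powGradient p A * (A - A')).trace.re := by
  have e1 : (powGradient p A * A).trace.re =
      ∑ i, ∑ j, (hA.eigenvalues i * |hA.eigenvalues i| ^ (p - 2)) * hA.eigenvalues i *
        overlap hA hA' i j := by
    rw [powGradient, trace_cfc_mul_self hA, trace_cfc_eq_sum_left hA hA']
  have e2 : (powGradient p A * A').trace.re =
      ∑ i, ∑ j, (hA.eigenvalues i * |hA.eigenvalues i| ^ (p - 2)) * hA'.eigenvalues j *
        overlap hA hA' i j := by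
    conv_lhs => rw [← cfc_id_matrix hA']
    rw [powGradient, trace_cfc_mul_cfc hA hA']
  rw [mul_sub, Matrix.trace_sub, Complex.sub_re, e1, e2, traceAbsRpow, traceAbsRpow,
    trace_cfc_eq_sum_left hA hA', trace_cfc_eq_sum_right hA hA']
  simp only [← Finset.sum_sub_distrib, Finset.mul_sum]
  refine Finset.sum_le_sum fun i _ => Finset.sum_le_sum fun j _ => ?_
  have := mul_le_mul_of_nonneg_right
    (abs_rpow_sub_le_gradient hp (hA.eigenvalues i) (hA'.eigenvalues j)) (overlap_nonneg hA hA' i j)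
  linarith

/-- In the mixed eigenbases A multiplies the rows of the change of basis by its eigenvalues, and A'
multiplies the columns by its own. -/
theorem norm_sq_eigenbasis_sub {A A' : Matrix ι ι ℂ} (hA : A.IsHermitian) (hA' : A'.IsHermitian)
    (i j : ι) : ‖(star (hA.eigenvectorUnitary : Matrix ι ι ℂ) * (A - A') *
      (hA'.eigenvectorUnitary : Matrix ι ι ℂ)) i j‖ ^ 2 =
      (hA.eigenvalues i - hA'.eigenvalues j) ^ 2 * overlap hA hA' i j := by
  have hU := Matrix.mem_unitaryGroup_iff'.1 hA.eigenvectorUnitary.2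
  have hV := Matrix.mem_unitaryGroup_iff'.1 hA'.eigenvectorUnitary.2
  have h1 : star (hA.eigenvectorUnitary : Matrix ι ι ℂ) * A =
      Matrix.diagonal (fun i => (hA.eigenvalues i : ℂ)) *
        star (hA.eigenvectorUnitary : Matrix ι ι ℂ) := by
    refine (congrArg (star (hA.eigenvectorUnitary : Matrix ι ι ℂ) * ·)
      (eq_mul_diagonal_mul hA)).trans ?_
    rw [← mul_assoc, ← mul_assoc, hU, one_mul]
  have h2 : A' * (hA'.eigenvectorUnitary : Matrix ι ι ℂ) =
      (hA'.eigenvectorUnitary : Matrix ι ι ℂ) *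
        Matrix.diagonal (fun i => (hA'.eigenvalues i : ℂ)) := by
    refine (congrArg (· * (hA'.eigenvectorUnitary : Matrix ι ι ℂ))
      (eq_mul_diagonal_mul hA')).trans ?_
    rw [mul_assoc, hV, mul_one]
  have hW : (eigenbasisChange hA hA' : Matrix ι ι ℂ) =
    star (hA.eigenvectorUnitary : Matrix ι ι ℂ) * (hA'.eigenvectorUnitary : Matrix ι ι ℂ) := rfl
  rw [mul_sub, sub_mul, h1, mul_assoc, mul_assoc, h2, ← mul_assoc (star _), ← hW,
    Matrix.sub_apply, Matrix.diagonal_mul, Matrix.mul_diagonal, mul_comm _ (hA'.eigenvalues j : ℂ),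
    ← sub_mul, ← Complex.ofReal_sub, norm_mul, Complex.norm_real, mul_pow, Real.norm_eq_abs, sq_abs]
  rfl

/-- The scalar bound produces the squared entries of A - A' in the mixed eigenbases, weighted by a
power of the mean of |l i|^p and |m j|^p. Diagonalising A - A' puts this sum in the form of
`sum_norm_sq_mul_rpow_le_holder`. -/
theorem trace_powGradient_sub_mul_sub_le {A A' : Matrix ι ι ℂ} (hA : A.IsHermitian)
    (hA' : A'.IsHermitian) {p : ℝ} (hp : 2 ≤ p) :
    ((powGradient p A - powGradient p A') * (A - A')).trace.re ≤
      (p - 1) * (traceAbsRpow p (A - A') ^ (2 / p) *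
        ((traceAbsRpow p A + traceAbsRpow p A') / 2) ^ ((p - 2) / p)) := by
  have hB := hA.sub hA'
  set l := hA.eigenvalues
  set m := hA'.eigenvalues
  set f : ℝ → ℝ := fun x => x * |x| ^ (p - 2) with hf
  have e1 : (powGradient p A * A).trace.re = ∑ i, ∑ j, f (l i) * l i * overlap hA hA' i j := by
    rw [powGradient, trace_cfc_mul_self hA, trace_cfc_eq_sum_left hA hA']
  have e2 : (powGradient p A * A').trace.re = ∑ i, ∑ j, f (l i) * m j * overlap hA hA' i j := by
    conv_lhs => rw [← cfc_id_matrix hA']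
    rw [powGradient, trace_cfc_mul_cfc hA hA']
  have e3 : (powGradient p A' * A).trace.re = ∑ i, ∑ j, l i * f (m j) * overlap hA hA' i j := by
    rw [Matrix.trace_mul_comm]
    conv_lhs => rw [← cfc_id_matrix hA]
    rw [powGradient, trace_cfc_mul_cfc hA hA']
  have e4 : (powGradient p A' * A').trace.re = ∑ i, ∑ j, f (m j) * m j * overlap hA hA' i j := by
    rw [powGradient, trace_cfc_mul_self hA', trace_cfc_eq_sum_right hA hA']
  set X := star hA.eigenvectorUnitary * hB.eigenvectorUnitary
  set Y := star hA'.eigenvectorUnitary * hB.eigenvectorUnitary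
  have hb : star (hA.eigenvectorUnitary : Matrix ι ι ℂ) * (A - A') *
      (hA'.eigenvectorUnitary : Matrix ι ι ℂ) = (X : Matrix ι ι ℂ) *
        Matrix.diagonal (fun k => (hB.eigenvalues k : ℂ)) * star (Y : Matrix ι ι ℂ) := by
    conv_lhs => rw [eq_mul_diagonal_mul hB]
    have hX : (X : Matrix ι ι ℂ) = star (hA.eigenvectorUnitary : Matrix ι ι ℂ) *
      (hB.eigenvectorUnitary : Matrix ι ι ℂ) := rfl
    have hY : (Y : Matrix ι ι ℂ) = star (hA'.eigenvectorUnitary : Matrix ι ι ℂ) *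
      (hB.eigenvectorUnitary : Matrix ι ι ℂ) := rfl
    rw [hX, hY, star_mul, star_star]
    simp only [mul_assoc]
  have hK := sum_norm_sq_mul_rpow_le_holder X Y hB.eigenvalues
    (c := fun i => |l i| ^ p) (c' := fun j => |m j| ^ p) (fun i => by positivity)
    (fun i => by positivity) hp
  rw [← hb, ← traceAbsRpow_eq_sum, ← traceAbsRpow_eq_sum, ← traceAbsRpow_eq_sum] at hK
  simp only [norm_sq_eigenbasis_sub] at hK
  calc _ = ∑ i, ∑ j, ((f (l i) - f (m j)) * (l i - m j)) * overlap hA hA' i j := by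
        rw [sub_mul, mul_sub, mul_sub]
        simp only [Matrix.trace_sub, Complex.sub_re]
        rw [e1, e2, e3, e4]
        simp only [← Finset.sum_sub_distrib]
        refine Finset.sum_congr rfl fun i _ => Finset.sum_congr rfl fun j _ => ?_
        ring
    _ ≤ ∑ i, ∑ j, (p - 1) * ((l i - m j) ^ 2 * overlap hA hA' i j *
          ((|l i| ^ p + |m j| ^ p) / 2) ^ ((p - 2) / p)) := by
        refine Finset.sum_le_sum fun i _ => Finset.sum_le_sum fun j _ => ?_
        have := mul_le_mul_of_nonneg_right
          (abs_rpow_gradient_sub_mul_le hp (l i) (m j)) (overlap_nonneg hA hA' i j)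
        calc _ ≤ _ := this
          _ = _ := by ring
    _ ≤ _ := by
        simp only [← Finset.mul_sum]
        exact mul_le_mul_of_nonneg_left hK (by linarith)

/-- Classical Hölder on pairs of indices, with each overlap w split as w^(1/p) · w^(1/q). -/
theorem trace_mul_le_holder {A K : Matrix ι ι ℂ} (hA : A.IsHermitian) (hK : K.IsHermitian)
    {p q : ℝ} (hpq : p.HolderConjugate q) :
    (A * K).trace.re ≤ traceAbsRpow p A ^ (1 / p) * traceAbsRpow q K ^ (1 / q) := by
  have e : (A * K).trace.re =
      ∑ i, ∑ j, hA.eigenvalues i * hK.eigenvalues j * overlap hA hK i j := by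
    conv_lhs => rw [← cfc_id_matrix hA, ← cfc_id_matrix hK]
    rw [trace_cfc_mul_cfc hA hK]
  have h := Real.inner_le_Lp_mul_Lq_of_nonneg (Finset.univ : Finset (ι × ι)) hpq
    (f := fun x => |hA.eigenvalues x.1| * overlap hA hK x.1 x.2 ^ (1 / p))
    (g := fun x => |hK.eigenvalues x.2| * overlap hA hK x.1 x.2 ^ (1 / q))
    (fun x _ => mul_nonneg (abs_nonneg _) (Real.rpow_nonneg (overlap_nonneg _ _ _ _) _))
    (fun x _ => mul_nonneg (abs_nonneg _) (Real.rpow_nonneg (overlap_nonneg _ _ _ _) _))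
  have hpow : ∀ (a w r : ℝ), 0 ≤ w → 0 < r → (|a| * w ^ (1 / r)) ^ r = |a| ^ r * w := by
    intro a w r hw hr
    rw [Real.mul_rpow (abs_nonneg _) (Real.rpow_nonneg hw _), ← Real.rpow_mul hw,
      one_div_mul_cancel hr.ne', Real.rpow_one]
  simp only [hpow _ _ _ (overlap_nonneg _ _ _ _) hpq.pos,
    hpow _ _ _ (overlap_nonneg _ _ _ _) hpq.symm.pos, Fintype.sum_prod_type] at h
  rw [traceAbsRpow, traceAbsRpow, trace_cfc_eq_sum_left hA hK, trace_cfc_eq_sum_right hA hK, e]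
  refine le_trans (Finset.sum_le_sum fun i _ => Finset.sum_le_sum fun j _ => ?_) h
  have hw : overlap hA hK i j ^ (1 / p) * overlap hA hK i j ^ (1 / q) = overlap hA hK i j := by
    rw [one_div, one_div]
    rcases (overlap_nonneg hA hK i j).eq_or_lt with h0 | h0
    · rw [← h0, Real.zero_rpow (inv_ne_zero hpq.ne_zero), zero_mul]
    · rw [← Real.rpow_add h0, hpq.inv_add_inv_eq_one, Real.rpow_one]
  calc _ ≤ |hA.eigenvalues i * hK.eigenvalues j| * overlap hA hK i j :=
        mul_le_mul_of_nonneg_right (le_abs_self _) (overlap_nonneg _ _ _ _)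
    _ = |hA.eigenvalues i| * |hK.eigenvalues j| *
        (overlap hA hK i j ^ (1 / p) * overlap hA hK i j ^ (1 / q)) := by rw [hw, abs_mul]
    _ = _ := by ring

end Hermitian

/-! ### Integration of the differential inequality. -/

/-- Formally (S^(2/p))' ≤ 2(p - 1) t N. As `S` is only continuous and may vanish, it is compared
with a strict supersolution through its right slopes. -/
theorem rpow_two_div_le_of_slope_le {S : ℝ → ℝ} (hS : Continuous S) (hS0 : ∀ t, 0 ≤ S t)
    {p N : ℝ} (hp : 2 ≤ p) (hN : 0 ≤ N)
    (h : ∀ s t, 0 ≤ s → s < t → S t - S s ≤ p * (t - s) * ((p - 1) * t * N * S t ^ ((p - 2) / p))) :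
    S 1 ^ (2 / p) ≤ S 0 ^ (2 / p) + (p - 1) * N := by
  have hp0 : 0 < p := by linarith
  have hr : 0 ≤ (p - 2) / p := div_nonneg (by linarith) hp0.le
  refine le_of_forall_pos_le_add fun δ hδ => ?_
  set ε := δ / 2 with hε
  have hε0 : 0 < ε := by positivity
  -- The constant ε keeps `u` positive, so its power is differentiable; the term ε x makes the
  -- comparison strict. At x = 1 they add up to δ.
  set u : ℝ → ℝ := fun x => S 0 ^ (2 / p) + ε + (p - 1) * N * x ^ 2 + ε * x with hu
  have hu0 : ∀ x, 0 ≤ x → 0 < u x := by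
    intro x hx
    have h1 := Real.rpow_nonneg (hS0 0) (2 / p)
    have h2 : 0 ≤ (p - 1) * N * x ^ 2 := by
      have : 0 ≤ p - 1 := by linarith
      positivity
    have h3 : 0 ≤ ε * x := by positivity
    simp only [hu]
    linarith
  have hder : ∀ x, 0 ≤ x → HasDerivAt (fun x => u x ^ (p / 2))
      ((2 * ((p - 1) * N) * x + ε) * (p / 2) * u x ^ (p / 2 - 1)) x := by
    intro x hx
    have h1 : HasDerivAt u (2 * ((p - 1) * N) * x + ε) x := by
      have h2 := (((hasDerivAt_pow 2 x).const_mul ((p - 1) * N)).const_add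
        (S 0 ^ (2 / p) + ε)).add ((hasDerivAt_id x).const_mul ε)
      refine h2.congr_deriv ?_
      push_cast
      ring
    exact h1.rpow_const (Or.inl (hu0 x hx).ne')
  have hcomp : ∀ x ∈ Set.Icc (0 : ℝ) 1, S x ≤ u x ^ (p / 2) := by
    refine image_le_of_liminf_slope_right_lt_deriv_boundary'
      (f' := fun x => p * ((p - 1) * x * N * S x ^ ((p - 2) / p)))
      (B' := fun x => (2 * ((p - 1) * N) * x + ε) * (p / 2) * u x ^ (p / 2 - 1))
      hS.continuousOn ?_ ?_ ?_ ?_ ?_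
    · intro x hx r hxr
      have hcont : Continuous fun z => p * ((p - 1) * z * N * S z ^ ((p - 2) / p)) :=
        continuous_const.mul (((continuous_const.mul continuous_id).mul continuous_const).mul
          (hS.rpow_const fun _ => Or.inr hr))
      have hev : ∀ᶠ z in 𝓝[>] x, p * ((p - 1) * z * N * S z ^ ((p - 2) / p)) < r :=
        (hcont.tendsto x).eventually_lt_const hxr |>.filter_mono nhdsWithin_le_nhds
      refine Eventually.frequently ?_
      filter_upwards [hev, self_mem_nhdsWithin] with z hz hxz
      have hxz : x < z := hxz
      refine lt_of_le_of_lt ?_ hz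
      rw [slope_def_field, div_le_iff₀ (sub_pos.2 hxz)]
      calc _ ≤ _ := h x z hx.1 hxz
        _ = _ := by ring
    · have h1 : S 0 = (S 0 ^ (2 / p)) ^ (p / 2) := by
        rw [← Real.rpow_mul (hS0 0)]
        have : 2 / p * (p / 2) = 1 := by field_simp
        rw [this, Real.rpow_one]
      conv_lhs => rw [h1]
      refine Real.rpow_le_rpow (Real.rpow_nonneg (hS0 0) _) ?_ (by positivity)
      simp only [hu]
      linarith
    · exact fun x hx => (hder x hx.1).continuousAt.continuousWithinAt
    · exact fun x hx => (hder x hx.1).hasDerivWithinAt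
    · intro x hx hSx
      have e : S x ^ ((p - 2) / p) = u x ^ (p / 2 - 1) := by
        rw [hSx, ← Real.rpow_mul (hu0 x hx.1).le]
        congr 1
        field_simp
      simp only [e]
      have hpos : 0 < u x ^ (p / 2 - 1) := Real.rpow_pos_of_pos (hu0 x hx.1) _
      have : 0 < ε * (p / 2) * u x ^ (p / 2 - 1) := by positivity
      linarith
  have h1 := Real.rpow_le_rpow (hS0 1) (hcomp 1 ⟨zero_le_one, le_rfl⟩) (z := 2 / p) (by positivity)
  rw [← Real.rpow_mul (hu0 1 zero_le_one).le] at h1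
  have : p / 2 * (2 / p) = 1 := by field_simp
  rw [this, Real.rpow_one] at h1
  refine h1.trans (le_of_eq ?_)
  simp only [hu, hε]
  ring

/-! ### Two-uniform smoothness and convexity under a unitary symmetry. -/

section Hermitian

variable {ι : Type*} [Fintype ι] [DecidableEq ι]

theorem traceAbsRpow_unitary_conj {A : Matrix ι ι ℂ} (hA : A.IsHermitian)
    (J : Matrix.unitaryGroup ι ℂ) (p : ℝ) :
    traceAbsRpow p ((J : Matrix ι ι ℂ) * A * star (J : Matrix ι ι ℂ)) = traceAbsRpow p A := by
  rw [traceAbsRpow, cfc_unitary_conj hA, Matrix.trace_mul_comm, ← mul_assoc,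
    Matrix.mem_unitaryGroup_iff'.1 J.2, one_mul, traceAbsRpow]

theorem cfc_smul_matrix {A : Matrix ι ι ℂ} (hA : A.IsHermitian) (c : ℝ) (g : ℝ → ℝ) :
    cfc g (c • A) = cfc (fun x => g (c * x)) A := by
  have h1 : c • A = cfc (fun x : ℝ => c * x) A := by
    rw [cfc_const_mul c (fun x : ℝ => x) A (continuousOn_spectrum_matrix A _), cfc_id_matrix hA]
  rw [h1, ← cfc_comp' g (fun x : ℝ => c * x) A
    (((Matrix.finite_real_spectrum (A := A)).image _).continuousOn _)
    (continuousOn_spectrum_matrix A _) hA.isSelfAdjoint]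

theorem traceAbsRpow_smul {A : Matrix ι ι ℂ} (hA : A.IsHermitian) (c p : ℝ) :
    traceAbsRpow p (c • A) = |c| ^ p * traceAbsRpow p A := by
  rw [traceAbsRpow, cfc_smul_matrix hA, trace_cfc hA, traceAbsRpow_eq_sum hA, Finset.mul_sum]
  refine Finset.sum_congr rfl fun i _ => ?_
  rw [abs_mul, Real.mul_rpow (abs_nonneg _) (abs_nonneg _)]

theorem isHermitian_smul {κ : Type*} {A : Matrix κ κ ℂ} (hA : A.IsHermitian) (c : ℝ) :
    (c • A).IsHermitian := IsSelfAdjoint.smul (IsSelfAdjoint.all c) hA.isSelfAdjoint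

theorem isHermitian_powGradient (A : Matrix ι ι ℂ) (p : ℝ) : (powGradient p A).IsHermitian :=
  isHermitian_cfc A _

theorem trace_mul_smul_re {κ : Type*} [Fintype κ] (F A : Matrix κ κ ℂ) (c : ℝ) :
    (F * (c • A)).trace.re = c * (F * A).trace.re := by
  rw [Matrix.mul_smul, Matrix.trace_smul, Complex.smul_re, smul_eq_mul]

theorem trace_unitary_conj_mul (J : Matrix.unitaryGroup ι ℂ) {F O : Matrix ι ι ℂ}
    (hO : (J : Matrix ι ι ℂ) * O * star (J : Matrix ι ι ℂ) = -O) :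
    ((J : Matrix ι ι ℂ) * F * star (J : Matrix ι ι ℂ) * O).trace = -(F * O).trace := by
  have hJ := Matrix.mem_unitaryGroup_iff'.1 J.2
  have h1 : (J : Matrix ι ι ℂ) * F * star (J : Matrix ι ι ℂ) * O =
      -((J : Matrix ι ι ℂ) * (F * O) * star (J : Matrix ι ι ℂ)) := by
    have h2 : O = -((J : Matrix ι ι ℂ) * O * star (J : Matrix ι ι ℂ)) := by rw [hO, neg_neg]
    calc _ = -((J : Matrix ι ι ℂ) * F * (star (J : Matrix ι ι ℂ) * J) * O * star (J : Matrix ι ι ℂ)) := by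
          conv_lhs => rw [h2]
          noncomm_ring
      _ = _ := by rw [hJ]; noncomm_ring
  rw [h1, Matrix.trace_neg, Matrix.trace_mul_comm, ← mul_assoc, hJ, one_mul]

theorem isHermitian_line {κ : Type*} {D O : Matrix κ κ ℂ} (hD : D.IsHermitian)
    (hO : O.IsHermitian) (t : ℝ) : (D + t • O).IsHermitian := hD.add (isHermitian_smul hO t)

theorem traceAbsRpow_line_sub_le {D O : Matrix ι ι ℂ} (hD : D.IsHermitian)
    (hO : O.IsHermitian) {p : ℝ} (hp : 1 < p) (s t : ℝ) :
    traceAbsRpow p (D + t • O) - traceAbsRpow p (D + s • O) ≤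
      p * (t - s) * (powGradient p (D + t • O) * O).trace.re := by
  have h := traceAbsRpow_sub_le (isHermitian_line hD hO t) (isHermitian_line hD hO s) hp
  rw [add_sub_add_left_eq_sub, ← sub_smul, trace_mul_smul_re] at h
  linarith

/-- Tangent lines below the graph at every point give convexity, and a finite convex function on ℝ
is continuous. -/
theorem continuous_traceAbsRpow_line {D O : Matrix ι ι ℂ} (hD : D.IsHermitian)
    (hO : O.IsHermitian) {p : ℝ} (hp : 1 < p) :
    Continuous fun t : ℝ => traceAbsRpow p (D + t • O) := by
  have hconv : ConvexOn ℝ Set.univ fun t : ℝ => traceAbsRpow p (D + t • O) := by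
    refine ⟨convex_univ, fun x _ y _ a b ha hb hab => ?_⟩
    simp only [smul_eq_mul]
    set z := a * x + b * y with hz
    have h1 := mul_le_mul_of_nonneg_left (traceAbsRpow_line_sub_le hD hO hp x z) ha
    have h2 := mul_le_mul_of_nonneg_left (traceAbsRpow_line_sub_le hD hO hp y z) hb
    set g := (powGradient p (D + z • O) * O).trace.re
    have h3 : a * (p * (z - x) * g) + b * (p * (z - y) * g) = 0 := by
      calc _ = p * g * ((a + b) * z - (a * x + b * y)) := by ring
        _ = 0 := by rw [hab, ← hz]; ring
    have h4 : a * (traceAbsRpow p (D + z • O) - traceAbsRpow p (D + x • O)) +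
        b * (traceAbsRpow p (D + z • O) - traceAbsRpow p (D + y • O)) =
        (a + b) * traceAbsRpow p (D + z • O) - (a * traceAbsRpow p (D + x • O) +
          b * traceAbsRpow p (D + y • O)) := by ring
    rw [hab] at h4
    linarith
  exact continuousOn_univ.1 (hconv.continuousOn isOpen_univ)

/-- Conjugation by `J` carries the point t of the line to -t and reverses the sign of the pairing
with `O`. The monotonicity estimate for the points ±t therefore contains this pairing twice; the
common factor 4t cancels. -/
theorem trace_powGradient_line_le {D O : Matrix ι ι ℂ} (hD : D.IsHermitian)
    (hO : O.IsHermitian) (J : Matrix.unitaryGroup ι ℂ)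
    (hJD : (J : Matrix ι ι ℂ) * D * star (J : Matrix ι ι ℂ) = D)
    (hJO : (J : Matrix ι ι ℂ) * O * star (J : Matrix ι ι ℂ) = -O) {p : ℝ} (hp : 2 ≤ p)
    {t : ℝ} (ht : 0 < t) :
    (powGradient p (D + t • O) * O).trace.re ≤ (p - 1) * t * traceAbsRpow p O ^ (2 / p) *
      traceAbsRpow p (D + t • O) ^ ((p - 2) / p) := by
  have hp0 : 0 < p := by linarith
  have hA := isHermitian_line hD hO t
  have hconj : D + (-t) • O =
      (J : Matrix ι ι ℂ) * (D + t • O) * star (J : Matrix ι ι ℂ) := by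
    rw [mul_add, add_mul, hJD, Matrix.mul_smul, Matrix.smul_mul, hJO, smul_neg, neg_smul]
  have h := trace_powGradient_sub_mul_sub_le hA (isHermitian_line hD hO (-t)) hp
  have hsub : D + t • O - (D + (-t) • O) = (2 * t) • O := by
    rw [add_sub_add_left_eq_sub, ← sub_smul]; congr 1; ring
  have hg : (powGradient p (D + (-t) • O) * O).trace = -(powGradient p (D + t • O) * O).trace := by
    rw [hconj, powGradient, cfc_unitary_conj hA, trace_unitary_conj_mul J hJO]
    rfl
  have hS : traceAbsRpow p (D + (-t) • O) = traceAbsRpow p (D + t • O) := by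
    rw [hconj, traceAbsRpow_unitary_conj hA]
  rw [hsub, hS, add_self_div_two, trace_mul_smul_re, sub_mul, Matrix.trace_sub, hg,
    traceAbsRpow_smul hO, Real.mul_rpow (by positivity) (traceAbsRpow_nonneg hO p),
    ← Real.rpow_mul (abs_nonneg _), mul_div_cancel₀ _ hp0.ne', Real.rpow_two, sq_abs] at h
  simp only [sub_neg_eq_add, Complex.add_re] at h
  have h4 : 0 < 4 * t := by positivity
  refine le_of_mul_le_mul_left ?_ h4
  calc _ = 2 * t * ((powGradient p (D + t • O) * O).trace.re +
        (powGradient p (D + t • O) * O).trace.re) := by ring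
    _ ≤ _ := h
    _ = _ := by ring

/-- The two-uniform smoothness inequality of Ball, Carlen and Lieb, in the case in which a
unitary symmetry exchanges `D + O` and `D - O`. -/
theorem traceAbsRpow_add_le {D O : Matrix ι ι ℂ} (hD : D.IsHermitian)
    (hO : O.IsHermitian) (J : Matrix.unitaryGroup ι ℂ)
    (hJD : (J : Matrix ι ι ℂ) * D * star (J : Matrix ι ι ℂ) = D)
    (hJO : (J : Matrix ι ι ℂ) * O * star (J : Matrix ι ι ℂ) = -O) {p : ℝ} (hp : 2 ≤ p) :
    traceAbsRpow p (D + O) ^ (2 / p) ≤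
      traceAbsRpow p D ^ (2 / p) + (p - 1) * traceAbsRpow p O ^ (2 / p) := by
  have h := rpow_two_div_le_of_slope_le (S := fun t : ℝ => traceAbsRpow p (D + t • O))
    (N := traceAbsRpow p O ^ (2 / p))
    (continuous_traceAbsRpow_line hD hO (by linarith))
    (fun t => traceAbsRpow_nonneg (isHermitian_line hD hO t) p) hp
    (Real.rpow_nonneg (traceAbsRpow_nonneg hO p) _) (fun s t hs hst => by
      refine (traceAbsRpow_line_sub_le hD hO (by linarith) s t).trans ?_
      exact mul_le_mul_of_nonneg_left
        (trace_powGradient_line_le hD hO J hJD hJO hp (by linarith))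
        (mul_nonneg (by linarith) (by linarith)))
  simpa using h

theorem traceAbsRpow_powGradient {A : Matrix ι ι ℂ} (hA : A.IsHermitian) {p q : ℝ}
    (hpq : p.HolderConjugate q) : traceAbsRpow q (powGradient p A) = traceAbsRpow p A := by
  rw [traceAbsRpow, powGradient, ← cfc_comp' (fun x : ℝ => |x| ^ q) (fun x : ℝ => x * |x| ^ (p - 2)) A
    (((Matrix.finite_real_spectrum (A := A)).image _).continuousOn _)
    (continuousOn_spectrum_matrix A _) hA.isSelfAdjoint, traceAbsRpow]
  congr 3
  ext x
  rcases eq_or_ne x 0 with rfl | hx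
  · simp [Real.zero_rpow hpq.ne_zero, Real.zero_rpow hpq.symm.ne_zero]
  have hx' : 0 < |x| := abs_pos.2 hx
  rw [abs_mul, abs_of_nonneg (Real.rpow_nonneg hx'.le (p - 2)), mul_comm,
    ← Real.rpow_add_one hx'.ne', ← Real.rpow_mul hx'.le]
  congr 1
  have := hpq.sub_one_mul_conj
  linarith

theorem trace_mul_powGradient {A : Matrix ι ι ℂ} (hA : A.IsHermitian) {p : ℝ} (hp : 0 < p) :
    (A * powGradient p A).trace.re = traceAbsRpow p A := by
  rw [Matrix.trace_mul_comm, powGradient, trace_cfc_mul_self hA, traceAbsRpow]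
  congr 3
  ext x
  rcases eq_or_ne x 0 with rfl | hx
  · simp [Real.zero_rpow hp.ne']
  have hx' : 0 < |x| := abs_pos.2 hx
  calc x * |x| ^ (p - 2) * x = |x| ^ (p - 2) * (|x| * |x|) := by rw [abs_mul_abs_self]; ring
    _ = |x| ^ p := by
      rw [← mul_assoc, ← Real.rpow_add_one hx'.ne', ← Real.rpow_add_one hx'.ne']
      ring_nf

theorem powGradient_neg {A : Matrix ι ι ℂ} (hA : A.IsHermitian) (p : ℝ) :
    powGradient p (-A) = -powGradient p A := by
  have h : -A = (-1 : ℝ) • A := by simp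
  rw [h, powGradient, cfc_smul_matrix hA, powGradient, ← cfc_neg]
  congr 1
  ext x
  simp

/-- The rescaled gradient of `Tr |A|^p`: it has `q`-norm `‖A‖_p` and pairs with `A` to `‖A‖_p ^ 2`. -/
theorem exists_dual {A : Matrix ι ι ℂ} (hA : A.IsHermitian) {p q : ℝ}
    (hpq : p.HolderConjugate q) (hp : p < 2) :
    ∃ c : ℝ, traceAbsRpow q (c • powGradient p A) ^ (2 / q) = traceAbsRpow p A ^ (2 / p) ∧
      (A * (c • powGradient p A)).trace.re = traceAbsRpow p A ^ (2 / p) := by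
  have hp0 := hpq.pos
  have hq0 := hpq.symm.pos
  have hS := traceAbsRpow_nonneg hA p
  set s := traceAbsRpow p A
  have hx : 2 / p = (2 - p) / p + 1 := by field_simp; ring
  have hinv := hpq.inv_add_inv_eq_one
  have hx2 : (2 - p) / p * 2 + 2 / q = 2 / p := by
    have : q⁻¹ = 1 - p⁻¹ := by linarith
    rw [div_eq_mul_inv 2 q, this]
    field_simp; ring
  -- The pairing of `A` with its gradient is `s`, so the factor must be s^(2/p - 1). As p < 2 this
  -- exponent is positive, which also covers s = 0.
  refine ⟨s ^ ((2 - p) / p), ?_, ?_⟩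
  · rw [traceAbsRpow_smul (isHermitian_powGradient _ _), traceAbsRpow_powGradient hA hpq,
      abs_of_nonneg (Real.rpow_nonneg hS _),
      Real.mul_rpow (Real.rpow_nonneg (Real.rpow_nonneg hS _) _) hS, ← Real.rpow_mul
        (Real.rpow_nonneg hS _), mul_div_cancel₀ _ hq0.ne', ← Real.rpow_mul hS,
        ← Real.rpow_add_of_nonneg hS (by have : 0 < 2 - p := by linarith
                                         positivity) (by positivity), hx2]
  · rw [trace_mul_smul_re, trace_mul_powGradient hA hp0, hx,
      Real.rpow_add_one' hS (by rw [← hx]; positivity)]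

/-- The two-uniform convexity inequality of Ball, Carlen and Lieb, in the case in which a
unitary symmetry exchanges `D + O` and `D - O`. -/
theorem le_traceAbsRpow_add {D O : Matrix ι ι ℂ} (hD : D.IsHermitian) (hO : O.IsHermitian)
    (J : Matrix.unitaryGroup ι ℂ)
    (hJD : (J : Matrix ι ι ℂ) * D * star (J : Matrix ι ι ℂ) = D)
    (hJO : (J : Matrix ι ι ℂ) * O * star (J : Matrix ι ι ℂ) = -O) {p : ℝ} (hp1 : 1 < p)
    (hp2 : p < 2) :
    traceAbsRpow p D ^ (2 / p) + (p - 1) * traceAbsRpow p O ^ (2 / p) ≤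
      traceAbsRpow p (D + O) ^ (2 / p) := by
  have hpq := Real.HolderConjugate.conjExponent hp1
  set q := Real.conjExponent p
  have hq1 : (q - 1) * (p - 1) = 1 := by
    have := hpq.mul_eq_add
    linarith
  have hq2 : 2 ≤ q := by nlinarith
  have hq0 : 0 < q := by linarith
  have hp0 : 0 < p := by linarith
  obtain ⟨a, ha1, ha2⟩ := exists_dual hD hpq hp2
  obtain ⟨b, hb1, hb2⟩ := exists_dual hO hpq hp2
  set D' := a • powGradient p D
  -- The factor p - 1 = 1/(q - 1) makes the smoothness bound for the dual pair and its pairing with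
  -- `D + O` the same number `v`.
  set O' := (p - 1) • b • powGradient p O with hO'
  have hD'h : D'.IsHermitian := isHermitian_smul (isHermitian_powGradient _ _) _
  have hO'h : O'.IsHermitian := isHermitian_smul (isHermitian_smul (isHermitian_powGradient _ _) _) _
  have hJD' : (J : Matrix ι ι ℂ) * D' * star (J : Matrix ι ι ℂ) = D' := by
    simp only [D', Matrix.mul_smul, Matrix.smul_mul]
    rw [powGradient, ← cfc_unitary_conj hD, hJD]
  have hJO' : (J : Matrix ι ι ℂ) * O' * star (J : Matrix ι ι ℂ) = -O' := by
    simp only [hO', Matrix.mul_smul, Matrix.smul_mul]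
    rw [powGradient, ← cfc_unitary_conj hO, hJO, ← powGradient, powGradient_neg hO, powGradient]
    simp only [smul_neg]
  -- Cross terms vanish by parity: conjugation by `J` fixes one factor and negates the other.
  have hDO' : (D * O').trace = 0 := by
    have h := trace_unitary_conj_mul J (F := D) hJO'
    rw [hJD] at h
    exact self_eq_neg.1 h
  have hOD' : (O * D').trace = 0 := by
    have h := trace_unitary_conj_mul J (F := D') hJO
    rw [hJD'] at h
    rw [Matrix.trace_mul_comm]
    exact self_eq_neg.1 h
  have hOO' : (O * O').trace.re = (p - 1) * traceAbsRpow p O ^ (2 / p) := by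
    rw [hO', trace_mul_smul_re, hb2]
  have hnO' : traceAbsRpow q O' ^ (2 / q) = (p - 1) ^ 2 * traceAbsRpow p O ^ (2 / p) := by
    rw [hO', traceAbsRpow_smul (isHermitian_smul (isHermitian_powGradient _ _) _),
      Real.mul_rpow (by positivity) (traceAbsRpow_nonneg (isHermitian_smul (isHermitian_powGradient _ _) _) _),
      hb1, ← Real.rpow_mul (abs_nonneg _), mul_div_cancel₀ _ hq0.ne', Real.rpow_two, sq_abs]
  have hsm := traceAbsRpow_add_le hD'h hO'h J hJD' hJO' hq2
  rw [ha1, hnO'] at hsm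
  have hho := trace_mul_le_holder (hD.add hO) (hD'h.add hO'h) hpq
  set v := traceAbsRpow p D ^ (2 / p) + (p - 1) * traceAbsRpow p O ^ (2 / p) with hv
  have hlhs : ((D + O) * (D' + O')).trace.re = v := by
    rw [mul_add, add_mul, add_mul]
    simp only [Matrix.trace_add, Complex.add_re, ha2, hDO', hOD', hOO', Complex.zero_re]
    rw [hv]; ring
  have hrhs : traceAbsRpow p D ^ (2 / p) + (q - 1) * ((p - 1) ^ 2 * traceAbsRpow p O ^ (2 / p)) = v := by
    rw [hv]
    linear_combination (p - 1) * traceAbsRpow p O ^ (2 / p) * hq1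
  rw [hrhs] at hsm
  rw [hlhs] at hho
  have hsq : ∀ {x r : ℝ}, 0 ≤ x → x ^ (2 / r) = (x ^ (1 / r)) ^ 2 := by
    intro x r hx
    rw [← Real.rpow_natCast, ← Real.rpow_mul hx]
    congr 1
    push_cast
    ring
  have hn1 := traceAbsRpow_nonneg (hD.add hO) p
  have hn2 := traceAbsRpow_nonneg (hD'h.add hO'h) q
  rw [hsq hn2] at hsm
  rw [hsq hn1]
  have hv0 : 0 ≤ v := by
    have h1 := Real.rpow_nonneg (traceAbsRpow_nonneg hD p) (2 / p)
    have h2 := Real.rpow_nonneg (traceAbsRpow_nonneg hO p) (2 / p)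
    have h3 : 0 ≤ p - 1 := by linarith
    positivity
  set m := traceAbsRpow p (D + O) ^ (1 / p)
  set k := traceAbsRpow q (D' + O') ^ (1 / q)
  -- Hölder and smoothness for q give v² ≤ ‖D + O‖_p² v; dividing by v needs v > 0.
  rcases hv0.eq_or_lt with h0 | h0
  · rw [← h0]; positivity
  · have h1 : v ^ 2 ≤ (m * k) ^ 2 := pow_le_pow_left₀ hv0 hho 2
    have h2 : (m * k) ^ 2 ≤ m ^ 2 * v := by
      rw [mul_pow]; gcongr
    refine le_of_mul_le_mul_right ?_ h0
    linarith

end Hermitian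

/-! ### Reduction of arbitrary and block matrices to Hermitian ones. -/

section Trace

variable {ι κ : Type*} [Fintype ι] [DecidableEq ι] [Fintype κ] [DecidableEq κ]

/-- Only the characteristic polynomial enters, so AB can be compared with BA and block diagonal
traces split without matching eigenbases. -/
theorem trace_cfc_eq_roots_sum {A : Matrix ι ι ℂ} (hA : A.IsHermitian) (g : ℝ → ℝ) :
    (cfc g A).trace.re = (A.charpoly.roots.map fun z => g z.re).sum := by
  rw [trace_cfc hA, hA.roots_charpoly_eq_eigenvalues, Multiset.map_map]
  rfl

theorem trace_cfc_mul_comm {A B : Matrix ι ι ℂ} (hAB : (A * B).IsHermitian)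
    (hBA : (B * A).IsHermitian) (g : ℝ → ℝ) :
    (cfc g (A * B)).trace.re = (cfc g (B * A)).trace.re := by
  rw [trace_cfc_eq_roots_sum hAB, trace_cfc_eq_roots_sum hBA, Matrix.charpoly_mul_comm]

theorem trace_cfc_fromBlocks_diagonal {A : Matrix ι ι ℂ} {B : Matrix κ κ ℂ}
    (hA : A.IsHermitian) (hB : B.IsHermitian) (g : ℝ → ℝ) :
    (cfc g (Matrix.fromBlocks A 0 0 B)).trace.re = (cfc g A).trace.re + (cfc g B).trace.re := by
  have h : (Matrix.fromBlocks A 0 0 B).IsHermitian :=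
    hA.fromBlocks (by simp) hB
  rw [trace_cfc_eq_roots_sum h, trace_cfc_eq_roots_sum hA, trace_cfc_eq_roots_sum hB,
    Matrix.charpoly_fromBlocks_zero₁₂, Polynomial.roots_mul, Multiset.map_add, Multiset.sum_add]
  exact ((Matrix.charpoly_monic A).mul (Matrix.charpoly_monic B)).ne_zero

theorem isHermitian_diagonal_ofReal {κ : Type*} [DecidableEq κ] (v : κ → ℝ) :
    (Matrix.diagonal fun i => (v i : ℂ)).IsHermitian := by
  refine Matrix.isHermitian_diagonal_of_self_adjoint _ ?_
  ext i
  simp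

theorem traceAbsRpow_diagonal (v : ι → ℝ) (p : ℝ) :
    traceAbsRpow p (Matrix.diagonal fun i => (v i : ℂ)) = ∑ i, |v i| ^ p := by
  have hroots : (∏ i, (Polynomial.X - Polynomial.C (v i : ℂ))).roots =
      Finset.univ.val.map fun i => (v i : ℂ) := by
    rw [← Polynomial.roots_multiset_prod_X_sub_C (Finset.univ.val.map fun i => (v i : ℂ)),
      Multiset.map_map]
    rfl
  rw [traceAbsRpow, trace_cfc_eq_roots_sum (isHermitian_diagonal_ofReal v),
    Matrix.charpoly_diagonal, hroots, Multiset.map_map]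
  simp

/-- `Tr (A* A)^(p/2)`. -/
noncomputable def traceGramRpow (p : ℝ) (A : Matrix ι ι ℂ) : ℝ :=
  (cfc (fun t : ℝ => t ^ (p / 2)) (A.conjTranspose * A)).trace.re

theorem pNorm_eq_traceGramRpow (p : ℝ) (A : Matrix ι ι ℂ) :
    pNorm p A = traceGramRpow p A ^ (1 / p) := rfl

theorem traceGramRpow_eq_sum (p : ℝ) (A : Matrix ι ι ℂ) :
    traceGramRpow p A =
      ∑ i, (Matrix.isHermitian_conjTranspose_mul_self A).eigenvalues i ^ (p / 2) :=
  trace_cfc _ _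

open scoped ComplexOrder in
theorem eigenvalues_gram_nonneg (A : Matrix ι ι ℂ) (i : ι) :
    0 ≤ (Matrix.isHermitian_conjTranspose_mul_self A).eigenvalues i :=
  (Matrix.posSemidef_conjTranspose_mul_self A).eigenvalues_nonneg i

theorem traceGramRpow_nonneg (p : ℝ) (A : Matrix ι ι ℂ) : 0 ≤ traceGramRpow p A := by
  rw [traceGramRpow_eq_sum]
  exact Finset.sum_nonneg fun i _ => Real.rpow_nonneg (eigenvalues_gram_nonneg A i) _

theorem pNorm_nonneg (p : ℝ) (A : Matrix ι ι ℂ) : 0 ≤ pNorm p A :=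
  Real.rpow_nonneg (traceGramRpow_nonneg p A) _

theorem pNorm_rpow {p : ℝ} (hp : 0 < p) (A : Matrix ι ι ℂ) : pNorm p A ^ p = traceGramRpow p A := by
  rw [pNorm_eq_traceGramRpow, ← Real.rpow_mul (traceGramRpow_nonneg p A),
    one_div_mul_cancel hp.ne', Real.rpow_one]

theorem rpow_two_div_eq_sq {x : ℝ} (hx : 0 ≤ x) (p : ℝ) : x ^ (2 / p) = (x ^ (1 / p)) ^ 2 := by
  rw [← Real.rpow_natCast, ← Real.rpow_mul hx]
  congr 1
  push_cast
  ring

theorem pNorm_sq (p : ℝ) (A : Matrix ι ι ℂ) : pNorm p A ^ 2 = traceGramRpow p A ^ (2 / p) := by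
  rw [rpow_two_div_eq_sq (traceGramRpow_nonneg p A), pNorm_eq_traceGramRpow]

/-- The Hermitian dilation of a square matrix. -/
def hermitianDilation {κ : Type*} (A : Matrix κ κ ℂ) : Matrix (κ ⊕ κ) (κ ⊕ κ) ℂ :=
  Matrix.fromBlocks 0 A A.conjTranspose 0

theorem isHermitian_hermitianDilation {κ : Type*} (A : Matrix κ κ ℂ) :
    (hermitianDilation A).IsHermitian := by
  rw [hermitianDilation]
  exact Matrix.IsHermitian.fromBlocks (by simp) rfl (by simp)

/-- The square of the dilation is block diagonal with blocks A A* and A* A, which have the same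
spectrum with multiplicities. -/
theorem traceAbsRpow_hermitianDilation (p : ℝ) (A : Matrix ι ι ℂ) :
    traceAbsRpow p (hermitianDilation A) = 2 * traceGramRpow p A := by
  have hA := isHermitian_hermitianDilation A
  have h1 : (fun x : ℝ => |x| ^ p) = fun x : ℝ => (x ^ 2) ^ (p / 2) := by
    ext x
    rw [← sq_abs, ← Real.rpow_natCast, ← Real.rpow_mul (abs_nonneg x)]
    congr 1
    push_cast
    ring
  have h2 : hermitianDilation A ^ 2 =
      Matrix.fromBlocks (A * A.conjTranspose) 0 0 (A.conjTranspose * A) := by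
    rw [sq, hermitianDilation, Matrix.fromBlocks_multiply]
    simp
  rw [traceAbsRpow, h1, cfc_comp' (fun t : ℝ => t ^ (p / 2)) (fun x : ℝ => x ^ 2) _
    (((Matrix.finite_real_spectrum (A := hermitianDilation A)).image _).continuousOn _)
    (continuousOn_spectrum_matrix _ _) hA.isSelfAdjoint,
    cfc_pow_id (hermitianDilation A) 2 hA.isSelfAdjoint, h2,
    trace_cfc_fromBlocks_diagonal (Matrix.isHermitian_mul_conjTranspose_self A)
      (Matrix.isHermitian_conjTranspose_mul_self A),
    trace_cfc_mul_comm (Matrix.isHermitian_mul_conjTranspose_self A)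
      (Matrix.isHermitian_conjTranspose_mul_self A), ← traceGramRpow]
  ring

theorem hermitianDilation_add {κ : Type*} (A B : Matrix κ κ ℂ) :
    hermitianDilation (A + B) = hermitianDilation A + hermitianDilation B := by
  simp [hermitianDilation, Matrix.fromBlocks_add]

theorem hermitianDilation_neg {κ : Type*} (A : Matrix κ κ ℂ) :
    hermitianDilation (-A) = -hermitianDilation A := by
  simp [hermitianDilation, Matrix.fromBlocks_neg]

/-- The block diagonal unitary with two copies of `J`. -/
def doubledUnitary (J : Matrix.unitaryGroup ι ℂ) : Matrix.unitaryGroup (ι ⊕ ι) ℂ :=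
  ⟨Matrix.fromBlocks J 0 0 J, by
    have h := Matrix.mem_unitaryGroup_iff.1 J.2
    rw [Matrix.star_eq_conjTranspose] at h
    rw [Matrix.mem_unitaryGroup_iff, Matrix.star_eq_conjTranspose, Matrix.fromBlocks_conjTranspose,
      Matrix.fromBlocks_multiply]
    simp [h]⟩

theorem doubledUnitary_conj (J : Matrix.unitaryGroup ι ℂ) (A : Matrix ι ι ℂ) :
    (doubledUnitary J : Matrix (ι ⊕ ι) (ι ⊕ ι) ℂ) * hermitianDilation A *
      star (doubledUnitary J : Matrix (ι ⊕ ι) (ι ⊕ ι) ℂ) =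
      hermitianDilation ((J : Matrix ι ι ℂ) * A * star (J : Matrix ι ι ℂ)) := by
  simp only [doubledUnitary, hermitianDilation, Matrix.star_eq_conjTranspose,
    Matrix.fromBlocks_conjTranspose, Matrix.fromBlocks_multiply]
  simp [mul_assoc]

/-- Dilation is additive and compatible with the symmetry, and it multiplies all three terms by the
same 2^(2/p). -/
theorem traceGramRpow_add_le {D O : Matrix ι ι ℂ} (J : Matrix.unitaryGroup ι ℂ)
    (hJD : (J : Matrix ι ι ℂ) * D * star (J : Matrix ι ι ℂ) = D)
    (hJO : (J : Matrix ι ι ℂ) * O * star (J : Matrix ι ι ℂ) = -O) {p : ℝ} (hp : 2 ≤ p) :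
    traceGramRpow p (D + O) ^ (2 / p) ≤
      traceGramRpow p D ^ (2 / p) + (p - 1) * traceGramRpow p O ^ (2 / p) := by
  have h := traceAbsRpow_add_le (isHermitian_hermitianDilation D) (isHermitian_hermitianDilation O)
    (doubledUnitary J) (by rw [doubledUnitary_conj, hJD])
    (by rw [doubledUnitary_conj, hJO, hermitianDilation_neg]) hp
  rw [← hermitianDilation_add] at h
  simp only [traceAbsRpow_hermitianDilation,
    Real.mul_rpow zero_le_two (traceGramRpow_nonneg p _)] at h
  refine le_of_mul_le_mul_left ?_ (Real.rpow_pos_of_pos zero_lt_two (2 / p))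
  linarith

theorem le_traceGramRpow_add {D O : Matrix ι ι ℂ} (J : Matrix.unitaryGroup ι ℂ)
    (hJD : (J : Matrix ι ι ℂ) * D * star (J : Matrix ι ι ℂ) = D)
    (hJO : (J : Matrix ι ι ℂ) * O * star (J : Matrix ι ι ℂ) = -O) {p : ℝ} (hp1 : 1 < p)
    (hp2 : p < 2) :
    traceGramRpow p D ^ (2 / p) + (p - 1) * traceGramRpow p O ^ (2 / p) ≤
      traceGramRpow p (D + O) ^ (2 / p) := by
  have h := le_traceAbsRpow_add (isHermitian_hermitianDilation D) (isHermitian_hermitianDilation O)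
    (doubledUnitary J) (by rw [doubledUnitary_conj, hJD])
    (by rw [doubledUnitary_conj, hJO, hermitianDilation_neg]) hp1 hp2
  rw [← hermitianDilation_add] at h
  simp only [traceAbsRpow_hermitianDilation,
    Real.mul_rpow zero_le_two (traceGramRpow_nonneg p _)] at h
  refine le_of_mul_le_mul_left ?_ (Real.rpow_pos_of_pos zero_lt_two (2 / p))
  linarith

theorem traceGramRpow_fromBlocks_diagonal (p : ℝ) (X Z : Matrix ι ι ℂ) :
    traceGramRpow p (Matrix.fromBlocks X 0 0 Z) = traceGramRpow p X + traceGramRpow p Z := by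
  rw [traceGramRpow, Matrix.fromBlocks_conjTranspose, Matrix.fromBlocks_multiply]
  simp only [Matrix.conjTranspose_zero, Matrix.mul_zero, Matrix.zero_mul, add_zero, zero_add]
  exact trace_cfc_fromBlocks_diagonal (Matrix.isHermitian_conjTranspose_mul_self X)
    (Matrix.isHermitian_conjTranspose_mul_self Z) _

theorem traceGramRpow_fromBlocks_offDiagonal (p : ℝ) (Y W : Matrix ι ι ℂ) :
    traceGramRpow p (Matrix.fromBlocks 0 Y W 0) = traceGramRpow p W + traceGramRpow p Y := by
  rw [traceGramRpow, Matrix.fromBlocks_conjTranspose, Matrix.fromBlocks_multiply]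
  simp only [Matrix.conjTranspose_zero, Matrix.mul_zero, Matrix.zero_mul, add_zero, zero_add]
  exact trace_cfc_fromBlocks_diagonal (Matrix.isHermitian_conjTranspose_mul_self W)
    (Matrix.isHermitian_conjTranspose_mul_self Y) _

/-- The grading unitary of a two by two block decomposition. -/
def blockGrading (ι : Type*) [Fintype ι] [DecidableEq ι] : Matrix.unitaryGroup (ι ⊕ ι) ℂ :=
  ⟨Matrix.fromBlocks 1 0 0 (-1), by
    rw [Matrix.mem_unitaryGroup_iff, Matrix.star_eq_conjTranspose, Matrix.fromBlocks_conjTranspose,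
      Matrix.fromBlocks_multiply]
    simp⟩

theorem blockGrading_conj (X Y W Z : Matrix ι ι ℂ) :
    (blockGrading ι : Matrix (ι ⊕ ι) (ι ⊕ ι) ℂ) * Matrix.fromBlocks X Y W Z *
      star (blockGrading ι : Matrix (ι ⊕ ι) (ι ⊕ ι) ℂ) = Matrix.fromBlocks X (-Y) (-W) Z := by
  simp only [blockGrading, Matrix.star_eq_conjTranspose,
    Matrix.fromBlocks_conjTranspose, Matrix.fromBlocks_multiply]
  simp

theorem fromBlocks_eq_diagonal_add_offDiagonal {κ : Type*} (X Y W Z : Matrix κ κ ℂ) :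
    Matrix.fromBlocks X Y W Z = Matrix.fromBlocks X 0 0 Z + Matrix.fromBlocks 0 Y W 0 := by
  simp [Matrix.fromBlocks_add]

theorem blockGrading_conj_diagonal (X Z : Matrix ι ι ℂ) :
    (blockGrading ι : Matrix (ι ⊕ ι) (ι ⊕ ι) ℂ) * Matrix.fromBlocks X 0 0 Z *
      star (blockGrading ι : Matrix (ι ⊕ ι) (ι ⊕ ι) ℂ) = Matrix.fromBlocks X 0 0 Z := by
  simp [blockGrading_conj]

theorem blockGrading_conj_offDiagonal (Y W : Matrix ι ι ℂ) :
    (blockGrading ι : Matrix (ι ⊕ ι) (ι ⊕ ι) ℂ) * Matrix.fromBlocks 0 Y W 0 *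
      star (blockGrading ι : Matrix (ι ⊕ ι) (ι ⊕ ι) ℂ) = -Matrix.fromBlocks 0 Y W 0 := by
  simp [blockGrading_conj, Matrix.fromBlocks_neg]

end Trace

/-! ### The two-point inequality. -/

/-- The unitary exchanging the two coordinates of `ℂ²`. -/
def coordinateSwap : Matrix.unitaryGroup (Fin 2) ℂ :=
  ⟨!![0, 1; 1, 0], by
    rw [Matrix.mem_unitaryGroup_iff]
    ext i j
    fin_cases i <;> fin_cases j <;> simp [Matrix.mul_apply, Fin.sum_univ_two]⟩

theorem coordinateSwap_conj_const (m : ℝ) :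
    (coordinateSwap : Matrix (Fin 2) (Fin 2) ℂ) *
      (Matrix.diagonal fun i => ((![m, m] i : ℝ) : ℂ)) *
      star (coordinateSwap : Matrix (Fin 2) (Fin 2) ℂ) =
      Matrix.diagonal fun i => ((![m, m] i : ℝ) : ℂ) := by
  ext i j
  fin_cases i <;> fin_cases j <;>
    simp [coordinateSwap, Matrix.mul_apply, Fin.sum_univ_two, Matrix.vecMul_diagonal]

theorem coordinateSwap_conj_alternating (d : ℝ) :
    (coordinateSwap : Matrix (Fin 2) (Fin 2) ℂ) *
      (Matrix.diagonal fun i => ((![d, -d] i : ℝ) : ℂ)) *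
      star (coordinateSwap : Matrix (Fin 2) (Fin 2) ℂ) =
      -Matrix.diagonal fun i => ((![d, -d] i : ℝ) : ℂ) := by
  ext i j
  fin_cases i <;> fin_cases j <;>
    simp [coordinateSwap, Matrix.mul_apply, Fin.sum_univ_two, Matrix.vecMul_diagonal]

theorem diagonal_const_add_alternating (m d : ℝ) :
    (Matrix.diagonal fun i => ((![m, m] i : ℝ) : ℂ)) +
      (Matrix.diagonal fun i => ((![d, -d] i : ℝ) : ℂ)) =
      Matrix.diagonal fun i => ((![m + d, m - d] i : ℝ) : ℂ) := by
  ext i j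
  fin_cases i <;> fin_cases j <;> simp [sub_eq_add_neg]

theorem rpow_abs_add_self {p : ℝ} (hp : 0 < p) (m : ℝ) :
    (|m| ^ p + |m| ^ p) ^ (2 / p) = 2 ^ (2 / p) * m ^ 2 := by
  rw [← two_mul, Real.mul_rpow zero_le_two (by positivity), ← Real.rpow_mul (abs_nonneg m),
    mul_div_cancel₀ _ hp.ne', Real.rpow_two, sq_abs]

/-- The smoothness inequality for D = diag(m, m) and O = diag(d, -d), which the coordinate swap
fixes and negates. -/
theorem two_point_le {p : ℝ} (hp : 2 ≤ p) (m d : ℝ) :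
    (|m + d| ^ p + |m - d| ^ p) ^ (2 / p) ≤ 2 ^ (2 / p) * (m ^ 2 + (p - 1) * d ^ 2) := by
  have h := traceAbsRpow_add_le (isHermitian_diagonal_ofReal ![m, m])
    (isHermitian_diagonal_ofReal ![d, -d]) coordinateSwap
    (coordinateSwap_conj_const m) (coordinateSwap_conj_alternating d) hp
  rw [diagonal_const_add_alternating] at h
  simp only [traceAbsRpow_diagonal, Fin.sum_univ_two, Matrix.cons_val_zero, Matrix.cons_val_one,
    abs_neg, rpow_abs_add_self (show 0 < p by linarith)] at h
  linarith

theorem le_two_point {p : ℝ} (hp1 : 1 < p) (hp2 : p < 2) (m d : ℝ) :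
    2 ^ (2 / p) * (m ^ 2 + (p - 1) * d ^ 2) ≤ (|m + d| ^ p + |m - d| ^ p) ^ (2 / p) := by
  have h := le_traceAbsRpow_add (isHermitian_diagonal_ofReal ![m, m])
    (isHermitian_diagonal_ofReal ![d, -d]) coordinateSwap
    (coordinateSwap_conj_const m) (coordinateSwap_conj_alternating d) hp1 hp2
  rw [diagonal_const_add_alternating] at h
  simp only [traceAbsRpow_diagonal, Fin.sum_univ_two, Matrix.cons_val_zero, Matrix.cons_val_one,
    abs_neg, rpow_abs_add_self (show 0 < p by linarith)] at h
  linarith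

/-! ### Assembly of the bound for finite exponents. -/

section Bound

variable {ι : Type*} [Fintype ι] [DecidableEq ι]

/-- The off-diagonal entry of `alphaMatrix`. -/
noncomputable def alphaOffDiagonal (p : ℝ) (Y W : Matrix ι ι ℂ) : ℝ :=
  ((1 / 2) * pNorm p Y ^ p + (1 / 2) * pNorm p W ^ p) ^ (1 / p)

/-- In terms of the mean and half-difference of the diagonal of α the bound takes the form m² + (p -
1)(d² + off²) in which the two inequalities combine. -/
theorem alphaBound_eq (p : ℝ) (X Y W Z : Matrix ι ι ℂ) :
    alphaBound p X Y W Z = 2 ^ (1 / p) * Real.sqrt (((pNorm p X + pNorm p Z) / 2) ^ 2 +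
      (p - 1) * (((pNorm p X - pNorm p Z) / 2) ^ 2 + alphaOffDiagonal p Y W ^ 2)) := by
  rw [alphaBound]
  congr 2
  simp only [alphaMatrix, sq, Matrix.trace_fin_two, Matrix.mul_fin_two, alphaOffDiagonal,
    Matrix.of_apply, Matrix.cons_val_zero, Matrix.cons_val_one, Matrix.cons_val']
  ring

theorem alphaBound_nonneg (p : ℝ) (X Y W Z : Matrix ι ι ℂ) : 0 ≤ alphaBound p X Y W Z := by
  rw [alphaBound]
  positivity

theorem alphaOffDiagonal_sq {p : ℝ} (hp : 0 < p) (Y W : Matrix ι ι ℂ) :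
    2 ^ (2 / p) * alphaOffDiagonal p Y W ^ 2 =
      traceGramRpow p (Matrix.fromBlocks 0 Y W 0) ^ (2 / p) := by
  have hY := traceGramRpow_nonneg p Y
  have hW := traceGramRpow_nonneg p W
  rw [alphaOffDiagonal, pNorm_rpow hp, pNorm_rpow hp, ← rpow_two_div_eq_sq (by positivity),
    ← Real.mul_rpow zero_le_two (by positivity), traceGramRpow_fromBlocks_offDiagonal]
  congr 1
  ring

theorem alphaBound_sq {p : ℝ} (hp : 1 ≤ p) (X Y W Z : Matrix ι ι ℂ) :
    alphaBound p X Y W Z ^ 2 = 2 ^ (2 / p) * (((pNorm p X + pNorm p Z) / 2) ^ 2 +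
      (p - 1) * ((pNorm p X - pNorm p Z) / 2) ^ 2) +
      (p - 1) * traceGramRpow p (Matrix.fromBlocks 0 Y W 0) ^ (2 / p) := by
  have : 0 ≤ p - 1 := by linarith
  rw [alphaBound_eq, mul_pow, Real.sq_sqrt (by positivity), ← rpow_two_div_eq_sq zero_le_two,
    ← alphaOffDiagonal_sq (by linarith)]
  ring

theorem two_point_pNorm {p : ℝ} (hp : 0 < p) (X Z : Matrix ι ι ℂ) :
    (|(pNorm p X + pNorm p Z) / 2 + (pNorm p X - pNorm p Z) / 2| ^ p +
      |(pNorm p X + pNorm p Z) / 2 - (pNorm p X - pNorm p Z) / 2| ^ p) ^ (2 / p) =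
      traceGramRpow p (Matrix.fromBlocks X 0 0 Z) ^ (2 / p) := by
  have h1 : (pNorm p X + pNorm p Z) / 2 + (pNorm p X - pNorm p Z) / 2 = pNorm p X := by ring
  have h2 : (pNorm p X + pNorm p Z) / 2 - (pNorm p X - pNorm p Z) / 2 = pNorm p Z := by ring
  rw [h1, h2, abs_of_nonneg (pNorm_nonneg p X), abs_of_nonneg (pNorm_nonneg p Z), pNorm_rpow hp,
    pNorm_rpow hp, traceGramRpow_fromBlocks_diagonal]

theorem pNorm_fromBlocks_le {p : ℝ} (hp : 2 ≤ p) (X Y W Z : Matrix ι ι ℂ) :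
    pNorm p (Matrix.fromBlocks X Y W Z) ≤ alphaBound p X Y W Z := by
  refine (sq_le_sq₀ (pNorm_nonneg _ _) (alphaBound_nonneg _ _ _ _ _)).1 ?_
  rw [pNorm_sq, alphaBound_sq (by linarith), fromBlocks_eq_diagonal_add_offDiagonal X Y W Z]
  -- Smoothness separates `D` from `O`; the two-point inequality then bounds the norm of `D`.
  have h1 := traceGramRpow_add_le (blockGrading ι) (blockGrading_conj_diagonal X Z)
    (blockGrading_conj_offDiagonal Y W) hp
  have h2 := two_point_le hp ((pNorm p X + pNorm p Z) / 2) ((pNorm p X - pNorm p Z) / 2)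
  rw [two_point_pNorm (by linarith)] at h2
  linarith

theorem le_pNorm_fromBlocks_of_one_lt {p : ℝ} (hp1 : 1 < p) (hp2 : p < 2)
    (X Y W Z : Matrix ι ι ℂ) :
    alphaBound p X Y W Z ≤ pNorm p (Matrix.fromBlocks X Y W Z) := by
  refine (sq_le_sq₀ (alphaBound_nonneg _ _ _ _ _) (pNorm_nonneg _ _)).1 ?_
  rw [pNorm_sq, alphaBound_sq (by linarith), fromBlocks_eq_diagonal_add_offDiagonal X Y W Z]
  have h1 := le_traceGramRpow_add (blockGrading ι) (blockGrading_conj_diagonal X Z)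
    (blockGrading_conj_offDiagonal Y W) hp1 hp2
  have h2 := le_two_point hp1 hp2 ((pNorm p X + pNorm p Z) / 2) ((pNorm p X - pNorm p Z) / 2)
  rw [two_point_pNorm (by linarith)] at h2
  linarith

end Bound

/-! ### Endpoint exponents: p = 1, 2 by continuity, p = ∞ as a limit. -/

section Exponent

variable {ι : Type*} [Fintype ι] [DecidableEq ι]

theorem continuousAt_pNorm {p : ℝ} (hp : 0 < p) (A : Matrix ι ι ℂ) :
    ContinuousAt (fun q : ℝ => pNorm q A) p := by
  have h1 : ContinuousAt (fun q : ℝ => traceGramRpow q A) p := by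
    simp only [traceGramRpow_eq_sum]
    refine tendsto_finsetSum _ fun i _ => ?_
    exact ContinuousAt.rpow (f := fun _ => _) continuousAt_const
      (continuousAt_id.div_const 2) (Or.inr (by simpa using hp))
  exact h1.rpow (continuousAt_const.div continuousAt_id hp.ne') (Or.inr (by simpa using hp))

theorem continuousAt_alphaBound {p : ℝ} (hp : 0 < p) (X Y W Z : Matrix ι ι ℂ) :
    ContinuousAt (fun q : ℝ => alphaBound q X Y W Z) p := by
  have hinv : ContinuousAt (fun q : ℝ => 1 / q) p :=
    continuousAt_const.div continuousAt_id hp.ne'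
  have hpow : ∀ A : Matrix ι ι ℂ, ContinuousAt (fun q : ℝ => pNorm q A ^ q) p := fun A =>
    (continuousAt_pNorm hp A).rpow continuousAt_id (Or.inr hp)
  have hoff : ContinuousAt (fun q : ℝ => alphaOffDiagonal q Y W) p :=
    ((continuousAt_const.mul (hpow Y)).add (continuousAt_const.mul (hpow W))).rpow hinv
      (Or.inr (by simpa using hp))
  have hX := continuousAt_pNorm hp X
  have hZ := continuousAt_pNorm hp Z
  simp only [alphaBound_eq]
  exact ((continuousAt_const (y := (2 : ℝ))).rpow hinv (Or.inl two_ne_zero)).mul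
    (((((hX.add hZ).div_const 2).pow 2).add ((continuousAt_id.sub continuousAt_const).mul
      ((((hX.sub hZ).div_const 2).pow 2).add (hoff.pow 2)))).sqrt)

theorem le_pNorm_fromBlocks {p : ℝ} (hp1 : 1 ≤ p) (hp2 : p ≤ 2) (X Y W Z : Matrix ι ι ℂ) :
    alphaBound p X Y W Z ≤ pNorm p (Matrix.fromBlocks X Y W Z) := by
  have hp0 : 0 < p := by linarith
  refine ContinuousWithinAt.closure_le (s := Set.Ioo 1 2)
    (by rw [closure_Ioo (by norm_num)]; exact ⟨hp1, hp2⟩)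
    (continuousAt_alphaBound hp0 X Y W Z).continuousWithinAt
    (continuousAt_pNorm hp0 _).continuousWithinAt
    fun q hq => le_pNorm_fromBlocks_of_one_lt hq.1 hq.2 X Y W Z

open scoped Matrix.Norms.L2Operator in
theorem opNorm_sq (A : Matrix ι ι ℂ) :
    opNorm A ^ 2 = ‖(Matrix.isHermitian_conjTranspose_mul_self A).eigenvalues‖ := by
  have hA := Matrix.isHermitian_conjTranspose_mul_self A
  have h1 : opNorm A = ‖A‖ := rfl
  rw [h1, sq, ← CStarRing.norm_star_mul_self, Matrix.star_eq_conjTranspose]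
  have h2 := congrArg norm (eq_mul_diagonal_mul hA)
  rw [CStarRing.norm_mul_mem_unitary _ (Unitary.star_mem hA.eigenvectorUnitary.2),
    CStarRing.norm_mem_unitary_mul _ hA.eigenvectorUnitary.2, Matrix.l2_opNorm_diagonal] at h2
  rw [h2]
  simp only [Pi.norm_def]
  congr 2
  ext i
  simp

theorem opNorm_nonneg (A : Matrix ι ι ℂ) : 0 ≤ opNorm A := norm_nonneg _

theorem opNorm_le_pNorm {p : ℝ} (hp : 0 < p) (A : Matrix ι ι ℂ) : opNorm A ≤ pNorm p A := by
  refine (sq_le_sq₀ (opNorm_nonneg A) (pNorm_nonneg p A)).1 ?_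
  rw [opNorm_sq, pNorm_sq, pi_norm_le_iff_of_nonneg (Real.rpow_nonneg (traceGramRpow_nonneg p A) _)]
  intro i
  have he := eigenvalues_gram_nonneg A
  rw [Real.norm_of_nonneg (he i), traceGramRpow_eq_sum]
  set e := (Matrix.isHermitian_conjTranspose_mul_self A).eigenvalues
  calc e i = (e i ^ (p / 2)) ^ (2 / p) := by
        rw [← Real.rpow_mul (he i)]
        have : p / 2 * (2 / p) = 1 := by field_simp
        rw [this, Real.rpow_one]
    _ ≤ _ := Real.rpow_le_rpow (Real.rpow_nonneg (he i) _)
        (Finset.single_le_sum (f := fun i => e i ^ (p / 2))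
          (fun j _ => Real.rpow_nonneg (he j) _) (Finset.mem_univ i)) (by positivity)

/-- Bernoulli's inequality applied to (1 + card)^(1/p). The rate 1/p, not mere convergence, is
needed to offset the factor p - 1 in the bound. -/
theorem pNorm_le_opNorm {p : ℝ} (hp : 1 ≤ p) (A : Matrix ι ι ℂ) :
    pNorm p A ≤ opNorm A * (1 + Fintype.card ι / p) := by
  have hp0 : 0 < p := by linarith
  have he := eigenvalues_gram_nonneg A
  have hn := opNorm_nonneg A
  have h1 : traceGramRpow p A ≤ (1 + Fintype.card ι) * opNorm A ^ p := by
    rw [traceGramRpow_eq_sum]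
    have h2 : ∀ i, (Matrix.isHermitian_conjTranspose_mul_self A).eigenvalues i ^ (p / 2) ≤
        opNorm A ^ p := by
      intro i
      have h3 : (Matrix.isHermitian_conjTranspose_mul_self A).eigenvalues i ≤ opNorm A ^ 2 := by
        rw [opNorm_sq]
        exact (le_abs_self _).trans
          (norm_le_pi_norm (Matrix.isHermitian_conjTranspose_mul_self A).eigenvalues i)
      calc _ ≤ (opNorm A ^ 2) ^ (p / 2) := Real.rpow_le_rpow (he i) h3 (by positivity)
        _ = _ := by
          rw [← Real.rpow_natCast, ← Real.rpow_mul hn]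
          congr 1
          push_cast
          ring
    refine (Finset.sum_le_sum fun i _ => h2 i).trans ?_
    rw [Finset.sum_const, nsmul_eq_mul, Finset.card_univ]
    have := Real.rpow_nonneg hn p
    linarith
  calc pNorm p A ≤ ((1 + Fintype.card ι) * opNorm A ^ p) ^ (1 / p) :=
        Real.rpow_le_rpow (traceGramRpow_nonneg p A) h1 (by positivity)
    _ = (1 + Fintype.card ι : ℝ) ^ (1 / p) * opNorm A := by
        rw [Real.mul_rpow (by positivity) (by positivity), ← Real.rpow_mul hn,
          mul_one_div_cancel hp0.ne', Real.rpow_one]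
    _ ≤ (1 + 1 / p * Fintype.card ι) * opNorm A := by
        refine mul_le_mul_of_nonneg_right (rpow_one_add_le_one_add_mul_self ?_ (by positivity) ?_) hn
        · exact le_trans (by norm_num) (Nat.cast_nonneg _)
        · rw [div_le_one hp0]; exact hp
    _ = _ := by ring

theorem abs_pNorm_sub_opNorm_le {p : ℝ} (hp : 1 ≤ p) (A : Matrix ι ι ℂ) :
    |pNorm p A - opNorm A| ≤ opNorm A * Fintype.card ι / p := by
  have h1 := opNorm_le_pNorm (show 0 < p by linarith) A
  have h2 := pNorm_le_opNorm hp A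
  rw [abs_of_nonneg (by linarith)]
  calc _ ≤ opNorm A * (1 + Fintype.card ι / p) - opNorm A := by linarith
    _ = _ := by ring

theorem tendsto_pNorm_atTop (A : Matrix ι ι ℂ) :
    Tendsto (fun p : ℝ => pNorm p A) atTop (𝓝 (opNorm A)) := by
  rw [tendsto_iff_dist_tendsto_zero]
  refine squeeze_zero' (Eventually.of_forall fun _ => dist_nonneg) ?_
    (tendsto_const_nhds (x := opNorm A * Fintype.card ι).div_atTop tendsto_id)
  filter_upwards [eventually_ge_atTop 1] with p hp
  exact abs_pNorm_sub_opNorm_le hp A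

theorem half_mul_opNorm_le_alphaOffDiagonal {p : ℝ} (hp : 1 ≤ p) (Y W : Matrix ι ι ℂ) :
    1 / 2 * opNorm Y ≤ alphaOffDiagonal p Y W ∧ 1 / 2 * opNorm W ≤ alphaOffDiagonal p Y W := by
  have hp0 : 0 < p := by linarith
  have key : ∀ a b : ℝ, 0 ≤ a → 0 ≤ b →
      1 / 2 * a ≤ ((1 / 2) * a ^ p + (1 / 2) * b ^ p) ^ (1 / p) := by
    intro a b ha hb
    calc 1 / 2 * a = ((1 / 2 * a) ^ p) ^ (1 / p) := by
          rw [← Real.rpow_mul (by positivity), mul_one_div_cancel hp0.ne', Real.rpow_one]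
      _ ≤ _ := by
          refine Real.rpow_le_rpow (by positivity) ?_ (by positivity)
          rw [Real.mul_rpow (by norm_num) ha]
          have h1 : (1 / 2 : ℝ) ^ p ≤ 1 / 2 := by
            have := Real.rpow_le_rpow_of_exponent_ge (x := 1 / 2) (by norm_num) (by norm_num) hp
            simpa using this
          have h2 := mul_le_mul_of_nonneg_right h1 (Real.rpow_nonneg ha p)
          have h3 := Real.rpow_nonneg hb p
          linarith
  have hY := opNorm_le_pNorm hp0 Y
  have hW := opNorm_le_pNorm hp0 W
  constructor
  · exact le_trans (by linarith) (key _ _ (pNorm_nonneg p Y) (pNorm_nonneg p W))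
  · rw [alphaOffDiagonal, add_comm]
    exact le_trans (by linarith) (key _ _ (pNorm_nonneg p W) (pNorm_nonneg p Y))

theorem tendsto_alphaBound_atTop_of_le {X Y W Z : Matrix ι ι ℂ} {c : ℝ} (hc : 0 < c)
    (h : ∀ᶠ p : ℝ in atTop,
      c ≤ ((pNorm p X - pNorm p Z) / 2) ^ 2 + alphaOffDiagonal p Y W ^ 2) :
    Tendsto (fun p : ℝ => alphaBound p X Y W Z) atTop atTop := by
  have h1 : Tendsto (fun p : ℝ => Real.sqrt ((p - 1) * c)) atTop atTop :=
    Real.tendsto_sqrt_atTop.comp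
      ((tendsto_atTop_add_const_right atTop (-1) tendsto_id).atTop_mul_const hc)
  refine tendsto_atTop_mono' atTop ?_ h1
  filter_upwards [h, eventually_ge_atTop 1] with p hp hp1
  have hp0 : 0 < p := by linarith
  rw [alphaBound_eq]
  have h2 : 1 ≤ (2 : ℝ) ^ (1 / p) := Real.one_le_rpow (by norm_num) (by positivity)
  refine le_trans (Real.sqrt_le_sqrt ?_) (le_mul_of_one_le_left (Real.sqrt_nonneg _) h2)
  have h3 := mul_le_mul_of_nonneg_left hp (show 0 ≤ p - 1 by linarith)
  have h4 := sq_nonneg ((pNorm p X + pNorm p Z) / 2)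
  linarith

theorem alphaOffDiagonal_eq_zero {p : ℝ} (hp : 1 ≤ p) {Y W : Matrix ι ι ℂ} (hY : opNorm Y = 0)
    (hW : opNorm W = 0) : alphaOffDiagonal p Y W = 0 := by
  have hp0 : p ≠ 0 := by linarith
  have h : ∀ A : Matrix ι ι ℂ, opNorm A = 0 → pNorm p A = 0 := by
    intro A hA
    have := pNorm_le_opNorm hp A
    rw [hA, zero_mul] at this
    exact le_antisymm this (pNorm_nonneg p A)
  rw [alphaOffDiagonal, h Y hY, h W hW, Real.zero_rpow hp0]
  simp [hp0]

/-- With equal limits ‖X‖_p - ‖Z‖_p is O(1/p), so (p - 1) times its square still tends to 0. -/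
theorem tendsto_alphaBound_of_opNorm_eq {X Y W Z : Matrix ι ι ℂ} (hY : opNorm Y = 0)
    (hW : opNorm W = 0) (hXZ : opNorm X = opNorm Z) :
    Tendsto (fun p : ℝ => alphaBound p X Y W Z) atTop (𝓝 (opNorm X)) := by
  have hX := tendsto_pNorm_atTop X
  have hZ := tendsto_pNorm_atTop Z
  rw [← hXZ] at hZ
  set a := opNorm X
  have h2 : Tendsto (fun p : ℝ => (2 : ℝ) ^ (1 / p)) atTop (𝓝 1) := by
    have := (tendsto_const_nhds (x := (2 : ℝ))).rpow
      ((tendsto_const_nhds (x := (1 : ℝ))).div_atTop (tendsto_id (x := atTop)))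
      (Or.inl two_ne_zero)
    simpa using this
  have hd : Tendsto (fun p : ℝ => (p - 1) * ((pNorm p X - pNorm p Z) / 2) ^ 2) atTop (𝓝 0) := by
    refine squeeze_zero' (g := fun p : ℝ => (a * Fintype.card ι) ^ 2 / p) ?_ ?_
      (tendsto_const_nhds.div_atTop tendsto_id)
    · filter_upwards [eventually_ge_atTop 1] with p hp
      exact mul_nonneg (by linarith) (sq_nonneg _)
    · filter_upwards [eventually_ge_atTop 1] with p hp
      have hp0 : 0 < p := by linarith
      have e1 := abs_pNorm_sub_opNorm_le hp X
      have e2 := abs_pNorm_sub_opNorm_le hp Z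
      rw [← hXZ] at e2
      have e3 : |(pNorm p X - pNorm p Z) / 2| ≤ a * Fintype.card ι / p := by
        rw [abs_le] at e1 e2 ⊢
        constructor <;> linarith [e1.1, e1.2, e2.1, e2.2]
      have e4 := pow_le_pow_left₀ (abs_nonneg _) e3 2
      rw [sq_abs] at e4
      calc _ ≤ p * (a * Fintype.card ι / p) ^ 2 := by
            apply mul_le_mul (by linarith) e4 (sq_nonneg _) hp0.le
        _ = _ := by field_simp
  have hlim := h2.mul (((((hX.add hZ).div_const 2).pow 2).add hd).sqrt)
  have ha : 0 ≤ a := opNorm_nonneg X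
  rw [one_mul, add_self_div_two, add_zero, Real.sqrt_sq ha] at hlim
  refine hlim.congr' ?_
  filter_upwards [eventually_ge_atTop 1] with p hp
  rw [alphaBound_eq, alphaOffDiagonal_eq_zero hp hY hW]
  simp

/-- The limit is finite exactly when Y and W vanish and X and Z have equal operator norms. Otherwise
the coefficient of p - 1 stays bounded away from 0 and the bound diverges. -/
theorem exists_tendsto_alphaBound (X Y W Z : Matrix ι ι ℂ) :
    ∃ L : ℝ≥0∞, Tendsto (fun p : ℝ => ENNReal.ofReal (alphaBound p X Y W Z)) atTop (𝓝 L) := by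
  by_cases hY : opNorm Y = 0
  · by_cases hW : opNorm W = 0
    · by_cases hXZ : opNorm X = opNorm Z
      · exact ⟨_, ENNReal.tendsto_ofReal (tendsto_alphaBound_of_opNorm_eq hY hW hXZ)⟩
      · refine ⟨⊤, ENNReal.tendsto_ofReal_nhds_top.2 (tendsto_alphaBound_atTop_of_le
          (c := ((opNorm X - opNorm Z) / 2) ^ 2 / 2) ?_ ?_)⟩
        · have : opNorm X - opNorm Z ≠ 0 := sub_ne_zero.2 hXZ
          positivity
        · have h := ((((tendsto_pNorm_atTop X).sub (tendsto_pNorm_atTop Z)).div_const 2).pow 2)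
          have hpos : 0 < ((opNorm X - opNorm Z) / 2) ^ 2 := by
            have : opNorm X - opNorm Z ≠ 0 := sub_ne_zero.2 hXZ
            positivity
          filter_upwards [h.eventually_const_le (half_lt_self hpos)] with p hp
          linarith [sq_nonneg (alphaOffDiagonal p Y W)]
    · have hpos : 0 < opNorm W := lt_of_le_of_ne (opNorm_nonneg W) (Ne.symm hW)
      refine ⟨⊤, ENNReal.tendsto_ofReal_nhds_top.2 (tendsto_alphaBound_atTop_of_le
        (c := (1 / 2 * opNorm W) ^ 2) (by positivity) ?_)⟩
      filter_upwards [eventually_ge_atTop 1] with p hp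
      have := pow_le_pow_left₀ (by positivity) (half_mul_opNorm_le_alphaOffDiagonal hp Y W).2 2
      linarith [sq_nonneg ((pNorm p X - pNorm p Z) / 2)]
  · have hpos : 0 < opNorm Y := lt_of_le_of_ne (opNorm_nonneg Y) (Ne.symm hY)
    refine ⟨⊤, ENNReal.tendsto_ofReal_nhds_top.2 (tendsto_alphaBound_atTop_of_le
      (c := (1 / 2 * opNorm Y) ^ 2) (by positivity) ?_)⟩
    filter_upwards [eventually_ge_atTop 1] with p hp
    have := pow_le_pow_left₀ (by positivity) (half_mul_opNorm_le_alphaOffDiagonal hp Y W).1 2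
    linarith [sq_nonneg ((pNorm p X - pNorm p Z) / 2)]

end Exponent

theorem theorem2 (n : ℕ) (X Y W Z : Matrix (Fin n) (Fin n) ℂ) :
    -- (a) `1 ≤ p ≤ 2`
    (∀ p : ℝ, 1 ≤ p → p ≤ 2 →
      alphaBound p X Y W Z ≤ pNorm p (Matrix.fromBlocks X Y W Z)) ∧
    -- (b) `2 ≤ p < ∞`
    (∀ p : ℝ, 2 ≤ p →
      pNorm p (Matrix.fromBlocks X Y W Z) ≤ alphaBound p X Y W Z) ∧
    -- (b) `p = ∞`: the right side is its limit in `[0, ∞]` as `p → ∞`, which exists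
    (∃ L : ℝ≥0∞,
      Tendsto (fun p : ℝ => ENNReal.ofReal (alphaBound p X Y W Z)) atTop (𝓝 L) ∧
      ENNReal.ofReal (opNorm (Matrix.fromBlocks X Y W Z)) ≤ L) := by
  refine ⟨fun p hp1 hp2 => le_pNorm_fromBlocks hp1 hp2 X Y W Z,
    fun p hp => pNorm_fromBlocks_le hp X Y W Z, ?_⟩
  obtain ⟨L, hL⟩ := exists_tendsto_alphaBound X Y W Z
  -- The operator norm is below the p-norm, hence below the bound, for every p ≥ 2; this passes to
  -- the limit.
  refine ⟨L, hL, ge_of_tendsto hL ?_⟩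
  filter_upwards [eventually_ge_atTop 2] with p hp
  exact ENNReal.ofReal_le_ofReal
    ((opNorm_le_pNorm (by linarith) _).trans (pNorm_fromBlocks_le hp X Y W Z))
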